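/- Let $(\mathcal C,\otimes,I)$ be a symmetric monoidal category with pushouts and pullbacks. Let $(\mathcal E,\mathcal M)$ be a factorisation system on $\mathcal C$ (subcategories containing all isomorphisms, such that every morphism factors as $e;m$ with $e\in\mathcal E$, $m\in\mathcal M$, and every commutative square $(e;m);b=a;(e';m')$ has a unique $s$ with $e;s=a;e'$ and $m;b=s;m'$) for which $\mathcal M$ consists of monomorphisms and is stable under pushout. Let $\mathcal A$ be a subcategory of $\mathcal C$ that contains $\mathcal M$, is stable under pullback, and is such that for every cospan $X\to Z\leftarrow Y$ in $\mathcal A$ the canonical map $X+_{X\times_Z Y}Y\to Z$ lies in $\mathcal M$. Suppose that $\mathcal M$ and $\mathcal A$ are closed under $\otimes$, that $\otimes$ preserves pushouts in $\mathcal C$ (for all spans $N\leftarrow Y\to K$ and $N'\leftarrow Y'\to K'$, the canonical map $(N\otimes N')+_{Y\otimes Y'}(K\otimes K')\to(N+_YK)\otimes(N'+_{Y'}K')$ is an isomorphism), and that $\otimes$ preserves pullbacks in $\mathcal A$ (the analogous canonical map is an isomorphism for all cospans in $\mathcal A$, with pullbacks taken in $\mathcal C$). Let $\mathrm{Span}(\mathcal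 A)$ be the category with the objects of $\mathcal C$ whose morphisms are the isomorphism classes of spans with legs in $\mathcal A$, composed by pullback in $\mathcal C$. Let $\mathrm{Cospan}(\mathcal C)$ be the category of isomorphism classes of cospans in $\mathcal C$, composed by pushout. Let $\mathrm{Corel}(\mathcal C)$ be the category of cospans modulo the equivalence relation generated by $(X\xrightarrow{f}N\xleftarrow{g}Y)\sim(X\xrightarrow{f;m}N'\xleftarrow{g;m}Y)$ for $m\colon N\to N'$ in $\mathcal M$. Let $\Gamma\colon\mathrm{Cospan}(\mathcal C)\to\mathrm{Corel}(\mathcal C)$ be the quotient functor, and let $\Pi\colon\mathrm{Span}(\mathcal A)\to\mathrm{Corel}(\mathcal C)$ be the identity-on-objects functor that sends a span to the corelation represented by its pushout cospan. Let $\mathcal Z$ be the category of zigzags in $\mathcal A$, made symmetric monoidal: its objects are those of $\mathcal C$, and its morphisms are finite sequences of composable forward and backward morphisms of $\mathcal A$, modulo the congruence generated by * the relations of $\mathcal A+_{|\mathcal A|}\mathcal A^{\mathrm{op}}$ (consecutive morphisms pointing in the same direction are composed, and identities are removed), * the interchange of a forward morphism $f$ and a backward morphism $g$ of $\mathcal A$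 that act on different factors of a tensor product, and * the identification of each associator, unitor and symmetry (and each tensor product of one of these with identities), pointing forwards, with its inverse, pointing backwards. Then $\mathrm{Span}(\mathcal A)$, $\mathrm{Cospan}(\mathcal C)$ and $\mathrm{Corel}(\mathcal C)$, as well as $\mathcal Z$, are symmetric monoidal categories, with the tensor product of $\mathcal C$ on objects, the componentwise tensor product of spans and cospans, and the structure isomorphisms of $\mathcal C$. The functors $\Pi$ and $\Gamma$ are strict symmetric monoidal. The square $$\begin{array}{ccc}\mathcal Z&\longrightarrow&\mathrm{Span}(\mathcal A)\\ \downarrow&&\downarrow{\scriptstyle\Pi}\\ \mathrm{Cospan}(\mathcal C)&\xrightarrow{\ \Gamma\ }&\mathrm{Corel}(\mathcal C)\end{array}$$ whose unlabelled functors are the identity on objects and send a forward (respectively backward) morphism of $\mathcal A$ to the span or cospan that it represents, is a pushout in each of the following six categories, whose objects are the symmetric monoidal categories: the one with the lax, the one with the strong and the one with the strict monoidal functors as morphisms, and the one with the lax, the one with the strong and the one with the strict symmetric monoidal functors as morphisms. -/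

import Mathlib

open CategoryTheory CategoryTheory.Limits CategoryTheory.MonoidalCategory

universe v u

namespace Corelations

set_option linter.unusedSectionVars false



/-! ### Factorisation systems and the standing assumptions -/

section Assumptions

variable {C : Type u} [Category.{v} C]

/-- A factorisation system `(E, M)`: two subcategories containing all isomorphisms, such that
every morphism factors as `e ≫ m`, and such that commutative squares between factored morphisms
have a unique filler at the middle objects. -/
class IsFactorisationSystem (E M : MorphismProperty C) : Prop where
  left_multiplicative : E.IsMultiplicative
  right_multiplicative : M.IsMultiplicative
  left_of_iso : MorphismProperty.isomorphisms C ≤ E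
  right_of_iso : MorphismProperty.isomorphisms C ≤ M
  factor : ∀ {X Y : C} (f : X ⟶ Y), ∃ (I : C) (e : X ⟶ I) (m : I ⟶ Y), E e ∧ M m ∧ e ≫ m = f
  existsUnique_filler : ∀ {X I Y X' I' Y' : C} (e : X ⟶ I) (m : I ⟶ Y) (e' : X' ⟶ I')
    (m' : I' ⟶ Y') (a : X ⟶ X') (b : Y ⟶ Y'), E e → M m → E e' → M m' →
    (e ≫ m) ≫ b = a ≫ (e' ≫ m') → ∃! s : I ⟶ I', e ≫ s = a ≫ e' ∧ m ≫ b = s ≫ m'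

/-- For every cospan `f, g` in `A`, the canonical map from the pushout of the pullback of the
cospan to the apex of the cospan lies in `M`. -/
class CanonicalMapsIn (A M : MorphismProperty C) : Prop where
  canonical_mem : ∀ {X Y Z P Q : C} {f : X ⟶ Z} {g : Y ⟶ Z} {p : P ⟶ X} {q : P ⟶ Y}
    {i : X ⟶ Q} {j : Y ⟶ Q} (m : Q ⟶ Z), A f → A g → IsPullback p q f g → IsPushout p q i j →
    i ≫ m = f → j ≫ m = g → M m

/-- The tensor product preserves pushouts: the tensor product of two pushout squares is a pushout
square, i.e. the canonical map `(N ⊗ N') +_{Y ⊗ Y'} (M ⊗ M') ⟶ (N +_Y M) ⊗ (N' +_{Y'} M')` is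
invertible. -/
class TensorPreservesPushouts (C : Type u) [Category.{v} C] [MonoidalCategory C] : Prop where
  tensor_isPushout : ∀ {Y N K P Y' N' K' P' : C} {f : Y ⟶ N} {g : Y ⟶ K} {i : N ⟶ P} {j : K ⟶ P}
    {f' : Y' ⟶ N'} {g' : Y' ⟶ K'} {i' : N' ⟶ P'} {j' : K' ⟶ P'},
    IsPushout f g i j → IsPushout f' g' i' j' →
    IsPushout (f ⊗ₘ f') (g ⊗ₘ g') (i ⊗ₘ i') (j ⊗ₘ j')

/-- The tensor product preserves pullbacks (taken in `C`) of cospans in `A`. -/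
class TensorPreservesPullbacks [MonoidalCategory C] (A : MorphismProperty C) : Prop where
  tensor_isPullback : ∀ {P N K Y P' N' K' Y' : C} {p : P ⟶ N} {q : P ⟶ K} {f : N ⟶ Y} {g : K ⟶ Y}
    {p' : P' ⟶ N'} {q' : P' ⟶ K'} {f' : N' ⟶ Y'} {g' : K' ⟶ Y'},
    A f → A g → A f' → A g' → IsPullback p q f g → IsPullback p' q' f' g' →
    IsPullback (p ⊗ₘ p') (q ⊗ₘ q') (f ⊗ₘ f') (g ⊗ₘ g')

end Assumptions

/-! ### Cospans and corelations -/

/-- A cospan `X ⟶ apex ⟵ Y`. -/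
structure Cospan {C : Type u} [Category.{v} C] (X Y : C) where
  apex : C
  inl : X ⟶ apex
  inr : Y ⟶ apex

/-- Two cospans are related if there is a map in `W` from the apex of the first to the apex of the
second that commutes with the legs. -/
def Cospan.Rel {C : Type u} [Category.{v} C] (W : MorphismProperty C) {X Y : C}
    (a b : Cospan X Y) : Prop :=
  ∃ m : a.apex ⟶ b.apex, W m ∧ a.inl ≫ m = b.inl ∧ a.inr ≫ m = b.inr

/-- The objects of the category of cospans modulo `W`. -/
@[ext]
structure CospanMod {C : Type u} [Category.{v} C] (W : MorphismProperty C) where of ::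
  obj : C

/-- Cospans modulo the equivalence relation generated by `Cospan.Rel W`. -/
def CospanMod.Hom {C : Type u} [Category.{v} C] (W : MorphismProperty C) (X Y : C) :
    Type (max u v) :=
  Quot (Cospan.Rel W (X := X) (Y := Y))

namespace CospanMod

section Basic

variable {C : Type u} [Category.{v} C] {W : MorphismProperty C}

/-- The class of the cospan `f, g`. -/
def cls (W : MorphismProperty C) {X Y N : C} (f : X ⟶ N) (g : Y ⟶ N) : Hom W X Y :=
  Quot.mk _ ⟨N, f, g⟩

theorem ind {X Y : C} {P : Hom W X Y → Prop} (h : ∀ {N : C} (f : X ⟶ N) (g : Y ⟶ N), P (cls W f g))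
    (a : Hom W X Y) : P a := by
  induction a using Quot.ind with
  | mk a => exact h a.inl a.inr

theorem sound {X Y N N' : C} {f : X ⟶ N} {g : Y ⟶ N} {f' : X ⟶ N'} {g' : Y ⟶ N'} (m : N ⟶ N')
    (hm : W m) (hf : f ≫ m = f') (hg : g ≫ m = g') : cls W f g = cls W f' g' :=
  Quot.sound ⟨m, hm, hf, hg⟩

variable [W.IsStableUnderCobaseChange]

theorem cls_eq_right {X Y Z N K K' P P' : C} (f : X ⟶ N) {g : Y ⟶ N} {h : Y ⟶ K} (k : Z ⟶ K)
    {i : N ⟶ P} {j : K ⟶ P} (sq : IsPushout g h i j) (m : K ⟶ K') (hm : W m)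
    {i' : N ⟶ P'} {j' : K' ⟶ P'} (sq' : IsPushout g (h ≫ m) i' j') :
    cls W (f ≫ i) (k ≫ j) = cls W (f ≫ i') ((k ≫ m) ≫ j') := by
  have hd : IsPushout m j j' (sq.desc i' (m ≫ j') (by simpa using sq'.w)) := by
    refine IsPushout.of_left (h₁₁ := h) (v₁₁ := g) (h₂₁ := i) ?_ (by simp) sq.flip
    simpa using sq'.flip
  exact sound _ (W.of_isPushout hd.flip hm) (by simp) (by simp)

theorem cls_eq_left {X Y Z N N' K P P' : C} (f : X ⟶ N) {g : Y ⟶ N} {h : Y ⟶ K} (k : Z ⟶ K)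
    {i : N ⟶ P} {j : K ⟶ P} (sq : IsPushout g h i j) (m : N ⟶ N') (hm : W m)
    {i' : N' ⟶ P'} {j' : K ⟶ P'} (sq' : IsPushout (g ≫ m) h i' j') :
    cls W (f ≫ i) (k ≫ j) = cls W ((f ≫ m) ≫ i') (k ≫ j') := by
  have hd : IsPushout m i i' (sq.desc (m ≫ i') j' (by simpa using sq'.w)) := by
    refine IsPushout.of_left (h₁₁ := g) (v₁₁ := h) (h₂₁ := j) ?_ (by simp) sq
    simpa using sq'
  exact sound _ (W.of_isPushout hd.flip hm) (by simp) (by simp)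

variable [W.IsMultiplicative]

theorem mem_of_isIso {X Y : C} (f : X ⟶ Y)
    [IsIso f] : W f := by
  rw [← Category.id_comp f]
  exact (W.cancel_right_of_respectsIso (𝟙 X) f).2 (W.id_mem X)

theorem cls_eq_of_isPushout {X Y Z N N' P P' : C} {f : X ⟶ N} {g : Y ⟶ N} {h : Y ⟶ N'} {k : Z ⟶ N'}
    {i : N ⟶ P} {j : N' ⟶ P} {i' : N ⟶ P'} {j' : N' ⟶ P'}
    (sq : IsPushout g h i j) (sq' : IsPushout g h i' j') :
    cls W (f ≫ i) (k ≫ j) = cls W (f ≫ i') (k ≫ j') :=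
  sound (sq.isoIsPushout _ _ sq').hom (mem_of_isIso _) (by simp) (by simp)

variable [HasPushouts C]

/-- Composition of classes of cospans by pushout. -/
noncomputable def comp {X Y Z : C} : Hom W X Y → Hom W Y Z → Hom W X Z :=
  Quot.lift₂ (fun a b => cls W (a.inl ≫ pushout.inl a.inr b.inl) (b.inr ≫ pushout.inr a.inr b.inl))
    (by
      rintro ⟨N, f, g⟩ ⟨K, h, k⟩ ⟨K', h', k'⟩ ⟨m, hm, hm₁, hm₂⟩
      dsimp only at m hm hm₁ hm₂ ⊢
      subst hm₁ hm₂
      exact cls_eq_right f k (IsPushout.of_hasPushout g h) m hm (IsPushout.of_hasPushout _ _))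
    (by
      rintro ⟨N, f, g⟩ ⟨N', f', g'⟩ ⟨K, h, k⟩ ⟨m, hm, hm₁, hm₂⟩
      dsimp only at m hm hm₁ hm₂ ⊢
      subst hm₁ hm₂
      exact cls_eq_left f k (IsPushout.of_hasPushout g h) m hm (IsPushout.of_hasPushout _ _))

theorem comp_cls {X Y Z N N' P : C} {f : X ⟶ N} {g : Y ⟶ N} {h : Y ⟶ N'} {k : Z ⟶ N'}
    {i : N ⟶ P} {j : N' ⟶ P} (sq : IsPushout g h i j) :
    comp (cls W f g) (cls W h k) = cls W (f ≫ i) (k ≫ j) :=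
  cls_eq_of_isPushout (IsPushout.of_hasPushout g h) sq

noncomputable instance category : Category.{max u v} (CospanMod W) where
  Hom X Y := Hom W X.obj Y.obj
  id X := cls W (𝟙 X.obj) (𝟙 X.obj)
  comp a b := comp a b
  id_comp {X Y} a := by
    induction a using ind with
    | h f g => rw [comp_cls (IsPushout.of_id_fst (f := f))]; simp
  comp_id {X Y} a := by
    induction a using ind with
    | h f g => rw [comp_cls (IsPushout.of_id_snd (f := g))]; simp
  assoc {X Y Z T} a b c := by
    induction a using ind with
    | h f g =>
    induction b using ind with
    | h h k =>
    induction c using ind with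
    | h p q =>
    have s₁ := IsPushout.of_hasPushout g h
    have s₂ := IsPushout.of_hasPushout k p
    have s₃ := IsPushout.of_hasPushout (pushout.inr g h) (pushout.inl k p)
    rw [comp_cls s₁, comp_cls s₂, comp_cls (s₂.paste_horiz s₃), comp_cls (s₁.paste_vert s₃)]
    simp

/-- The morphism represented by a cospan. -/
def homMk {X Y : CospanMod W} {N : C} (f : X.obj ⟶ N) (g : Y.obj ⟶ N) : X ⟶ Y := cls W f g

theorem hom_ind {X Y : CospanMod W} {P : (X ⟶ Y) → Prop}
    (h : ∀ {N : C} (f : X.obj ⟶ N) (g : Y.obj ⟶ N), P (homMk f g)) (a : X ⟶ Y) : P a :=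
  ind h a

theorem homMk_sound {X Y : CospanMod W} {N N' : C} {f : X.obj ⟶ N} {g : Y.obj ⟶ N}
    {f' : X.obj ⟶ N'} {g' : Y.obj ⟶ N'} (m : N ⟶ N') (hm : W m) (hf : f ≫ m = f')
    (hg : g ≫ m = g') : (homMk f g : X ⟶ Y) = homMk f' g' :=
  sound m hm hf hg

theorem homMk_comp {X Y Z : CospanMod W} {N N' P : C} {f : X.obj ⟶ N} {g : Y.obj ⟶ N}
    {h : Y.obj ⟶ N'} {k : Z.obj ⟶ N'} {i : N ⟶ P} {j : N' ⟶ P} (sq : IsPushout g h i j) :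
    (homMk f g : X ⟶ Y) ≫ (homMk h k : Y ⟶ Z) = homMk (f ≫ i) (k ≫ j) :=
  comp_cls sq

theorem id_eq (X : CospanMod W) : 𝟙 X = homMk (𝟙 X.obj) (𝟙 X.obj) := rfl

/-- The morphism `f` of `C` as the cospan `f, 𝟙`. -/
def fwd {X Y : C} (f : X ⟶ Y) : (of X : CospanMod W) ⟶ of Y := homMk f (𝟙 Y)

/-- The morphism `g` of `C`, pointing backwards, as the cospan `𝟙, g`. -/
def bwd {X Y : C} (g : Y ⟶ X) : (of X : CospanMod W) ⟶ of Y := homMk (𝟙 X) g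

theorem fwd_comp {X Y Z : C} (f : X ⟶ Y) (g : Y ⟶ Z) :
    (fwd (f ≫ g) : (of X : CospanMod W) ⟶ of Z) = fwd f ≫ fwd g := by
  simp only [fwd]
  rw [homMk_comp (IsPushout.of_id_fst (f := g))]
  simp

theorem bwd_comp {X Y Z : C} (f : Y ⟶ X) (g : Z ⟶ Y) :
    (bwd (g ≫ f) : (of X : CospanMod W) ⟶ of Z) = bwd f ≫ bwd g := by
  simp only [bwd]
  rw [homMk_comp (IsPushout.of_id_snd (f := f))]
  simp

theorem fwd_id (X : C) : fwd (𝟙 X) = 𝟙 (of X : CospanMod W) := rfl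

theorem bwd_id (X : C) : bwd (𝟙 X) = 𝟙 (of X : CospanMod W) := rfl

theorem fwd_eq_bwd_inv {X Y : C} (e : X ≅ Y) :
    (fwd e.hom : (of X : CospanMod W) ⟶ of Y) = bwd e.inv :=
  homMk_sound e.inv (mem_of_isIso _) (by simp) (by simp)

theorem bwd_comp_fwd {X Y N P : C} {f : N ⟶ X} {g : N ⟶ Y} {i : X ⟶ P} {j : Y ⟶ P}
    (sq : IsPushout f g i j) :
    (bwd f : (of X : CospanMod W) ⟶ of N) ≫ fwd g = homMk i j := by
  simp only [fwd, bwd]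
  rw [homMk_comp sq]
  simp

theorem fwd_comp_bwd {X Y N : C} (f : X ⟶ N) (g : Y ⟶ N) :
    (fwd f : (of X : CospanMod W) ⟶ of N) ≫ bwd g = homMk f g := by
  simp only [fwd, bwd]
  rw [homMk_comp (IsPushout.of_id_fst (f := 𝟙 N))]
  simp

theorem bwd_comp_fwd_iso {X Y : C} (e : X ≅ Y) :
    (bwd e.hom : (of Y : CospanMod W) ⟶ of X) ≫ fwd e.hom = 𝟙 (of Y) := by
  rw [fwd_eq_bwd_inv, ← bwd_comp, e.inv_hom_id, bwd_id]

theorem bwd_comp_fwd_iso_assoc {X Y : C} (e : X ≅ Y) {Z : CospanMod W} (a : of Y ⟶ Z) :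
    (bwd e.hom : (of Y : CospanMod W) ⟶ of X) ≫ fwd e.hom ≫ a = a := by
  rw [← Category.assoc, bwd_comp_fwd_iso, Category.id_comp]

/-- An isomorphism of `C` as an isomorphism of cospans. -/
@[simps]
def ofIso {X Y : C} (e : X ≅ Y) : (of X : CospanMod W) ≅ of Y where
  hom := fwd e.hom
  inv := fwd e.inv
  hom_inv_id := by rw [← fwd_comp, e.hom_inv_id, fwd_id]
  inv_hom_id := by rw [← fwd_comp, e.inv_hom_id, fwd_id]

/-- A morphism of cospans, followed by a forward isomorphism, in terms of representatives. -/
theorem homMk_fwd_iso {X : CospanMod W} {Y Z N : C} (f : X.obj ⟶ N) (g : Y ⟶ N) (e : Y ≅ Z) :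
    (homMk f g : X ⟶ of Y) ≫ fwd e.hom = homMk f (e.inv ≫ g) := by
  rw [fwd_eq_bwd_inv, bwd, homMk_comp (IsPushout.of_id_snd (f := g))]
  simp

theorem fwd_homMk {X : C} {Y : CospanMod W} {Z N : C} (e : X ⟶ Z) (f : Z ⟶ N) (g : Y.obj ⟶ N) :
    (fwd e : (of X : CospanMod W) ⟶ of Z) ≫ (homMk f g : of Z ⟶ Y) = homMk (e ≫ f) g := by
  rw [fwd, homMk_comp (IsPushout.of_id_fst (f := f))]
  simp

/-- Naturality of isomorphisms of `C` with respect to cospans. -/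
theorem homMk_naturality {X Y X' Y' N N' : C} (f : X ⟶ N) (g : Y ⟶ N) (f' : X' ⟶ N') (g' : Y' ⟶ N')
    (eX : X ≅ X') (eY : Y ≅ Y') (eN : N ≅ N') (hf : f ≫ eN.hom = eX.hom ≫ f')
    (hg : g ≫ eN.hom = eY.hom ≫ g') :
    (homMk f g : (of X : CospanMod W) ⟶ of Y) ≫ fwd eY.hom = fwd eX.hom ≫ homMk f' g' := by
  rw [homMk_fwd_iso, fwd_homMk]
  exact homMk_sound eN.hom (mem_of_isIso _) hf (by simp [hg])

end Basic

section Monoidal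

variable {C : Type u} [Category.{v} C] [MonoidalCategory C] {W : MorphismProperty C}
  [W.IsMonoidal]

/-- Tensor product of classes of cospans, componentwise on representatives. -/
def tensor {X Y X' Y' : C} : Hom W X Y → Hom W X' Y' → Hom W (X ⊗ X') (Y ⊗ Y') :=
  Quot.map₂ (fun a b => ⟨a.apex ⊗ b.apex, a.inl ⊗ₘ b.inl, a.inr ⊗ₘ b.inr⟩)
    (by
      rintro a b b' ⟨m, hm, hm₁, hm₂⟩
      exact ⟨a.apex ◁ m, W.whiskerLeft_mem _ _ hm, by simp [← hm₁, ← id_tensorHom],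
        by simp [← hm₂, ← id_tensorHom]⟩)
    (by
      rintro a a' b ⟨m, hm, hm₁, hm₂⟩
      exact ⟨m ▷ b.apex, W.whiskerRight_mem _ hm _, by simp [← hm₁, ← tensorHom_id],
        by simp [← hm₂, ← tensorHom_id]⟩)

variable [HasPushouts C] [W.IsStableUnderCobaseChange]

noncomputable instance : MonoidalCategoryStruct (CospanMod W) where
  tensorObj X Y := of (X.obj ⊗ Y.obj)
  tensorHom f g := tensor f g
  whiskerLeft X _ _ g := tensor (𝟙 X) g
  whiskerRight f Y := tensor f (𝟙 Y)
  tensorUnit := of (𝟙_ C)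
  associator X Y Z := ofIso (α_ X.obj Y.obj Z.obj)
  leftUnitor X := ofIso (λ_ X.obj)
  rightUnitor X := ofIso (ρ_ X.obj)

theorem tensor_obj (X Y : CospanMod W) : (X ⊗ Y).obj = X.obj ⊗ Y.obj := rfl

variable (W) in
theorem unit_obj : (𝟙_ (CospanMod W)).obj = 𝟙_ C := rfl

theorem homMk_tensor {X Y X' Y' : CospanMod W} {N N' : C} (f : X.obj ⟶ N) (g : Y.obj ⟶ N)
    (f' : X'.obj ⟶ N') (g' : Y'.obj ⟶ N') :
    (homMk f g : X ⟶ Y) ⊗ₘ (homMk f' g' : X' ⟶ Y') = homMk (f ⊗ₘ f') (g ⊗ₘ g') := rfl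

theorem fwd_tensor {X Y X' Y' : C} (f : X ⟶ Y) (f' : X' ⟶ Y') :
    (fwd f : (of X : CospanMod W) ⟶ of Y) ⊗ₘ (fwd f' : (of X' : CospanMod W) ⟶ of Y') =
      fwd (f ⊗ₘ f') := by
  simp only [fwd]
  rw [homMk_tensor]
  simp

theorem bwd_tensor {X Y X' Y' : C} (f : Y ⟶ X) (f' : Y' ⟶ X') :
    (bwd f : (of X : CospanMod W) ⟶ of Y) ⊗ₘ (bwd f' : (of X' : CospanMod W) ⟶ of Y') =
      bwd (f ⊗ₘ f') := by
  simp only [bwd]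
  rw [homMk_tensor]
  simp

theorem id_tensor_id (X Y : CospanMod W) : 𝟙 X ⊗ₘ 𝟙 Y = 𝟙 (X ⊗ Y) := by
  simp only [id_eq]
  rw [homMk_tensor]
  simp only [id_tensorHom_id]
  rfl

theorem fwd_whiskerRight {X Y : C} (f : X ⟶ Y) (Z : CospanMod W) :
    (fwd f : (of X : CospanMod W) ⟶ of Y) ▷ Z = fwd (f ▷ Z.obj) :=
  (fwd_tensor f (𝟙 Z.obj)).trans (congrArg fwd (tensorHom_id _ _))

theorem whiskerLeft_fwd {X Y : C} (f : X ⟶ Y) (Z : CospanMod W) :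
    Z ◁ (fwd f : (of X : CospanMod W) ⟶ of Y) = fwd (Z.obj ◁ f) :=
  (fwd_tensor (𝟙 Z.obj) f).trans (congrArg fwd (id_tensorHom _ _))

theorem bwd_whiskerRight {X Y : C} (f : Y ⟶ X) (Z : CospanMod W) :
    (bwd f : (of X : CospanMod W) ⟶ of Y) ▷ Z = bwd (f ▷ Z.obj) :=
  (bwd_tensor f (𝟙 Z.obj)).trans (congrArg bwd (tensorHom_id _ _))

theorem whiskerLeft_bwd {X Y : C} (f : Y ⟶ X) (Z : CospanMod W) :
    Z ◁ (bwd f : (of X : CospanMod W) ⟶ of Y) = bwd (Z.obj ◁ f) :=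
  (bwd_tensor (𝟙 Z.obj) f).trans (congrArg bwd (id_tensorHom _ _))

variable [TensorPreservesPushouts C]

theorem tensor_comp {X₁ Y₁ Z₁ X₂ Y₂ Z₂ : CospanMod W} (f₁ : X₁ ⟶ Y₁) (f₂ : X₂ ⟶ Y₂)
    (g₁ : Y₁ ⟶ Z₁) (g₂ : Y₂ ⟶ Z₂) : (f₁ ⊗ₘ f₂) ≫ (g₁ ⊗ₘ g₂) = (f₁ ≫ g₁) ⊗ₘ (f₂ ≫ g₂) := by
  induction f₁ using hom_ind with
  | h a b =>
  induction f₂ using hom_ind with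
  | h c d =>
  induction g₁ using hom_ind with
  | h p q =>
  induction g₂ using hom_ind with
  | h r s =>
  have s₁ := IsPushout.of_hasPushout b p
  have s₂ := IsPushout.of_hasPushout d r
  rw [homMk_comp s₁, homMk_comp s₂, homMk_tensor, homMk_tensor, homMk_tensor,
    homMk_comp (TensorPreservesPushouts.tensor_isPushout s₁ s₂)]
  simp

noncomputable instance monoidal : MonoidalCategory (CospanMod W) :=
  MonoidalCategory.ofTensorHom
    (id_tensorHom_id := id_tensor_id)
    (id_tensorHom := fun _ _ _ _ => rfl)
    (tensorHom_id := fun _ _ => rfl)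
    (tensorHom_comp_tensorHom := tensor_comp)
    (associator_naturality := by
      intro X₁ X₂ X₃ Y₁ Y₂ Y₃ f₁ f₂ f₃
      induction f₁ using hom_ind with
      | h a b =>
      induction f₂ using hom_ind with
      | h c d =>
      induction f₃ using hom_ind with
      | h p q =>
      simp only [homMk_tensor]
      exact homMk_naturality _ _ _ _ (α_ _ _ _) (α_ _ _ _) (α_ _ _ _) (by simp) (by simp))
    (leftUnitor_naturality := by
      intro X Y f
      induction f using hom_ind with
      | h a b =>
      rw [id_eq, homMk_tensor]
      exact homMk_naturality _ _ _ _ (λ_ _) (λ_ _) (λ_ _) (by simp [unit_obj]) (by simp [unit_obj]))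
    (rightUnitor_naturality := by
      intro X Y f
      induction f using hom_ind with
      | h a b =>
      rw [id_eq, homMk_tensor]
      exact homMk_naturality _ _ _ _ (ρ_ _) (ρ_ _) (ρ_ _) (by simp [unit_obj]) (by simp [unit_obj]))
    (pentagon := by
      intro X Y Z T
      change (fwd _ ⊗ₘ fwd (𝟙 _)) ≫ fwd _ ≫ (fwd (𝟙 _) ⊗ₘ fwd _) = fwd _ ≫ fwd _
      simp only [fwd_tensor]
      simp only [← fwd_comp]
      simp only [tensorHom_id, id_tensorHom]
      exact congrArg fwd (MonoidalCategory.pentagon _ _ _ _))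
    (triangle := by
      intro X Y
      change fwd _ ≫ (fwd (𝟙 _) ⊗ₘ fwd _) = fwd _ ⊗ₘ fwd (𝟙 _)
      simp only [fwd_tensor]
      simp only [← fwd_comp]
      simp only [tensorHom_id, id_tensorHom]
      exact congrArg fwd (MonoidalCategory.triangle _ _))

variable [SymmetricCategory C]

noncomputable instance symmetric : SymmetricCategory (CospanMod W) where
  braiding X Y := ofIso (β_ X.obj Y.obj)
  braiding_naturality_right X Y Z f := by
    induction f using hom_ind with
    | h a b =>
    exact homMk_naturality _ _ _ _ (β_ _ _) (β_ _ _) (β_ _ _) (by simp) (by simp)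
  braiding_naturality_left f Z := by
    induction f using hom_ind with
    | h a b =>
    exact homMk_naturality _ _ _ _ (β_ _ _) (β_ _ _) (β_ _ _) (by simp) (by simp)
  hexagon_forward X Y Z := by
    change fwd _ ≫ fwd _ ≫ fwd _ = (fwd _ ⊗ₘ fwd (𝟙 _)) ≫ fwd _ ≫ (fwd (𝟙 _) ⊗ₘ fwd _)
    simp only [fwd_tensor]
    simp only [← fwd_comp]
    simp only [tensorHom_id, id_tensorHom]
    exact congrArg fwd (BraidedCategory.hexagon_forward _ _ _)
  hexagon_reverse X Y Z := by
    change fwd _ ≫ fwd _ ≫ fwd _ = (fwd (𝟙 _) ⊗ₘ fwd _) ≫ fwd _ ≫ (fwd _ ⊗ₘ fwd (𝟙 _))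
    simp only [fwd_tensor]
    simp only [← fwd_comp]
    simp only [tensorHom_id, id_tensorHom]
    exact congrArg fwd (BraidedCategory.hexagon_reverse _ _ _)
  symmetry X Y := by
    change fwd _ ≫ fwd _ = fwd (𝟙 _)
    simp only [← fwd_comp]
    simp

end Monoidal
end CospanMod

/-! ### Spans in a subcategory -/

/-- The objects of the category of spans in `A`. -/
@[ext]
structure SpanCat {C : Type u} [Category.{v} C] (A : MorphismProperty C) where of ::
  obj : C

/-- Isomorphism classes of spans with both legs in `A`. -/
def SpanCat.Hom {C : Type u} [Category.{v} C] (A : MorphismProperty C) (X Y : C) :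
    Type (max u v) :=
  Quot (fun S T : Span A A X Y => Nonempty (S ≅ T))

namespace SpanCat

section Basic

variable {C : Type u} [Category.{v} C] {A : MorphismProperty C}

/-- The class of the span `f, g`. -/
def cls {X Y N : C} (f : N ⟶ X) (g : N ⟶ Y) (hf : A f) (hg : A g) : Hom A X Y :=
  Quot.mk _ ⟨N, f, g, hf, hg⟩

theorem ind {X Y : C} {P : Hom A X Y → Prop}
    (h : ∀ {N : C} (f : N ⟶ X) (g : N ⟶ Y) (hf : A f) (hg : A g), P (cls f g hf hg))
    (a : Hom A X Y) : P a := by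
  induction a using Quot.ind with
  | mk a => exact h a.l a.r a.wl a.wr

theorem sound {X Y N N' : C} {f : N ⟶ X} {g : N ⟶ Y} {f' : N' ⟶ X} {g' : N' ⟶ Y}
    {hf : A f} {hg : A g} {hf' : A f'} {hg' : A g'} (e : N ≅ N')
    (h₁ : e.hom ≫ f' = f) (h₂ : e.hom ≫ g' = g) : cls f g hf hg = cls f' g' hf' hg' :=
  Quot.sound ⟨Span.mkIso e h₁ h₂⟩

theorem cls_congr {X Y N : C} {f f' : N ⟶ X} {g g' : N ⟶ Y} {hf : A f} {hg : A g} {hf' : A f'}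
    {hg' : A g'} (h₁ : f = f') (h₂ : g = g') : cls f g hf hg = cls f' g' hf' hg' := by
  subst h₁ h₂; rfl

/-- The isomorphism of apexes underlying an isomorphism of spans. -/
@[simps]
def apexIso {X Y : C} {S T : Span A A X Y} (e : S ≅ T) : S.apex ≅ T.apex where
  hom := e.hom.hom
  inv := e.inv.hom
  hom_inv_id := by rw [← Span.comp_hom, e.hom_inv_id, Span.id_hom]
  inv_hom_id := by rw [← Span.comp_hom, e.inv_hom_id, Span.id_hom]

variable [A.IsMultiplicative] [A.IsStableUnderBaseChange]

theorem mem_of_isIso {X Y : C} (f : X ⟶ Y) [IsIso f] : A f := by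
  rw [← Category.id_comp f]
  exact (A.cancel_right_of_respectsIso (𝟙 X) f).2 (A.id_mem X)

theorem comp_left_mem {X Y N K P : C} {f : N ⟶ X} {g : N ⟶ Y} {h : K ⟶ Y} {i : P ⟶ N} {j : P ⟶ K}
    (hf : A f) (hh : A h) (sq : IsPullback i j g h) : A (i ≫ f) :=
  A.comp_mem _ _ (A.of_isPullback sq.flip hh) hf

theorem comp_right_mem {Y Z N K P : C} {g : N ⟶ Y} {h : K ⟶ Y} {k : K ⟶ Z} {i : P ⟶ N} {j : P ⟶ K}
    (hg : A g) (hk : A k) (sq : IsPullback i j g h) : A (j ≫ k) :=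
  A.comp_mem _ _ (A.of_isPullback sq hg) hk

variable [HasPullbacks C]

/-- Composition of classes of spans by pullback in `C`. -/
noncomputable def comp {X Y Z : C} : Hom A X Y → Hom A Y Z → Hom A X Z :=
  Quot.lift₂ (fun a b => cls (pullback.fst a.r b.l ≫ a.l) (pullback.snd a.r b.l ≫ b.r)
      (comp_left_mem a.wl b.wl (IsPullback.of_hasPullback _ _))
      (comp_right_mem a.wr b.wr (IsPullback.of_hasPullback _ _)))
    (by
      rintro a b b' ⟨e⟩
      have : IsIso e.hom.hom := (apexIso e).isIso_hom
      exact sound (asIso (pullback.map a.r b.l a.r b'.l (𝟙 _) e.hom.hom (𝟙 _) (by simp)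
        (by simp))) (by simp [pullback.map, pullback.lift_fst_assoc])
        (by simp [pullback.map, pullback.lift_snd_assoc]))
    (by
      rintro a a' b ⟨e⟩
      have : IsIso e.hom.hom := (apexIso e).isIso_hom
      exact sound (asIso (pullback.map a.r b.l a'.r b.l e.hom.hom (𝟙 _) (𝟙 _) (by simp)
        (by simp))) (by simp [pullback.map, pullback.lift_fst_assoc])
        (by simp [pullback.map, pullback.lift_snd_assoc]))

theorem comp_cls {X Y Z N N' P : C} {f : N ⟶ X} {g : N ⟶ Y} {h : N' ⟶ Y} {k : N' ⟶ Z}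
    {i : P ⟶ N} {j : P ⟶ N'} (sq : IsPullback i j g h) (hf : A f) (hg : A g) (hh : A h)
    (hk : A k) :
    comp (cls f g hf hg) (cls h k hh hk) =
      cls (i ≫ f) (j ≫ k) (comp_left_mem hf hh sq) (comp_right_mem hg hk sq) :=
  sound ((IsPullback.of_hasPullback g h).isoIsPullback _ _ sq) (by simp) (by simp)

noncomputable instance category : Category.{max u v} (SpanCat A) where
  Hom X Y := Hom A X.obj Y.obj
  id X := cls (𝟙 X.obj) (𝟙 X.obj) (A.id_mem _) (A.id_mem _)
  comp a b := comp a b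
  id_comp {X Y} a := by
    induction a using ind with
    | h f g hf hg =>
      rw [comp_cls (IsPullback.of_id_snd (f := f))]
      exact cls_congr (by simp) (by simp)
  comp_id {X Y} a := by
    induction a using ind with
    | h f g hf hg =>
      rw [comp_cls (IsPullback.of_id_fst (f := g))]
      exact cls_congr (by simp) (by simp)
  assoc {X Y Z T} a b c := by
    induction a using ind with
    | h f g hf hg =>
    induction b using ind with
    | h h k hh hk =>
    induction c using ind with
    | h p q hp hq =>
    have s₁ := IsPullback.of_hasPullback g h
    have s₂ := IsPullback.of_hasPullback k p
    have s₃ := IsPullback.of_hasPullback (pullback.snd g h) (pullback.fst k p)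
    rw [comp_cls s₁, comp_cls s₂, comp_cls (s₃.paste_vert s₂),
      comp_cls (s₃.paste_horiz s₁)]
    exact cls_congr (by simp) (by simp)

/-- The morphism represented by a span. -/
def homMk {X Y : SpanCat A} {N : C} (f : N ⟶ X.obj) (g : N ⟶ Y.obj) (hf : A f) (hg : A g) :
    X ⟶ Y := cls f g hf hg

theorem hom_ind {X Y : SpanCat A} {P : (X ⟶ Y) → Prop}
    (h : ∀ {N : C} (f : N ⟶ X.obj) (g : N ⟶ Y.obj) (hf : A f) (hg : A g), P (homMk f g hf hg))
    (a : X ⟶ Y) : P a :=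
  ind h a

theorem homMk_sound {X Y : SpanCat A} {N N' : C} {f : N ⟶ X.obj} {g : N ⟶ Y.obj} {f' : N' ⟶ X.obj}
    {g' : N' ⟶ Y.obj} {hf : A f} {hg : A g} {hf' : A f'} {hg' : A g'} (e : N ≅ N')
    (h₁ : e.hom ≫ f' = f) (h₂ : e.hom ≫ g' = g) :
    (homMk f g hf hg : X ⟶ Y) = homMk f' g' hf' hg' :=
  sound e h₁ h₂

theorem homMk_congr {X Y : SpanCat A} {N : C} {f f' : N ⟶ X.obj} {g g' : N ⟶ Y.obj} {hf : A f}
    {hg : A g} {hf' : A f'} {hg' : A g'} (h₁ : f = f') (h₂ : g = g') :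
    (homMk f g hf hg : X ⟶ Y) = homMk f' g' hf' hg' :=
  cls_congr h₁ h₂

theorem homMk_comp {X Y Z : SpanCat A} {N N' P : C} {f : N ⟶ X.obj} {g : N ⟶ Y.obj}
    {h : N' ⟶ Y.obj} {k : N' ⟶ Z.obj} {i : P ⟶ N} {j : P ⟶ N'} (sq : IsPullback i j g h)
    (hf : A f) (hg : A g) (hh : A h) (hk : A k) :
    (homMk f g hf hg : X ⟶ Y) ≫ (homMk h k hh hk : Y ⟶ Z) =
      homMk (i ≫ f) (j ≫ k) (comp_left_mem hf hh sq) (comp_right_mem hg hk sq) :=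
  comp_cls sq hf hg hh hk

theorem id_eq (X : SpanCat A) : 𝟙 X = homMk (𝟙 X.obj) (𝟙 X.obj) (A.id_mem _) (A.id_mem _) := rfl

/-- The morphism `f` of `A` as the span `𝟙, f`. -/
def fwd {X Y : C} (f : X ⟶ Y) (hf : A f) : (of X : SpanCat A) ⟶ of Y :=
  homMk (𝟙 X) f (A.id_mem _) hf

/-- The morphism `g` of `A`, pointing backwards, as the span `g, 𝟙`. -/
def bwd {X Y : C} (g : Y ⟶ X) (hg : A g) : (of X : SpanCat A) ⟶ of Y :=
  homMk g (𝟙 Y) hg (A.id_mem _)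

theorem fwd_comp {X Y Z : C} (f : X ⟶ Y) (g : Y ⟶ Z) (hf : A f) (hg : A g) :
    (fwd f hf : (of X : SpanCat A) ⟶ of Y) ≫ fwd g hg = fwd (f ≫ g) (A.comp_mem _ _ hf hg) := by
  simp only [fwd]
  rw [homMk_comp (IsPullback.of_id_fst (f := f))]
  exact homMk_congr (by simp) rfl

theorem bwd_comp {X Y Z : C} (f : Y ⟶ X) (g : Z ⟶ Y) (hf : A f) (hg : A g) :
    (bwd f hf : (of X : SpanCat A) ⟶ of Y) ≫ bwd g hg = bwd (g ≫ f) (A.comp_mem _ _ hg hf) := by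
  simp only [bwd]
  rw [homMk_comp (IsPullback.of_id_snd (f := g))]
  exact homMk_congr rfl (by simp)

theorem fwd_id (X : C) : fwd (𝟙 X) (A.id_mem _) = 𝟙 (of X : SpanCat A) := rfl

theorem bwd_id (X : C) : bwd (𝟙 X) (A.id_mem _) = 𝟙 (of X : SpanCat A) := rfl

theorem fwd_eq_bwd_inv {X Y : C} (e : X ≅ Y) :
    (fwd e.hom (mem_of_isIso _) : (of X : SpanCat A) ⟶ of Y) = bwd e.inv (mem_of_isIso _) :=
  homMk_sound e (by simp) (by simp)

theorem fwd_congr {X Y : C} {f f' : X ⟶ Y} {hf : A f} {hf' : A f'} (h : f = f') :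
    (fwd f hf : (of X : SpanCat A) ⟶ of Y) = fwd f' hf' := by
  subst h; rfl

/-- An isomorphism of `C` as an isomorphism of spans. -/
@[simps]
def ofIso {X Y : C} (e : X ≅ Y) : (of X : SpanCat A) ≅ of Y where
  hom := fwd e.hom (mem_of_isIso _)
  inv := fwd e.inv (mem_of_isIso _)
  hom_inv_id := by rw [fwd_comp, ← fwd_id]; exact fwd_congr e.hom_inv_id
  inv_hom_id := by rw [fwd_comp, ← fwd_id]; exact fwd_congr e.inv_hom_id

/-- Naturality of isomorphisms of `C` with respect to spans. -/
theorem homMk_naturality {X Y X' Y' N N' : C} {f : N ⟶ X} {g : N ⟶ Y} {f' : N' ⟶ X'} {g' : N' ⟶ Y'}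
    {hfA : A f} {hgA : A g} {hfA' : A f'} {hgA' : A g'}
    (eX : X ≅ X') (eY : Y ≅ Y') (eN : N ≅ N') (hf : f ≫ eX.hom = eN.hom ≫ f')
    (hg : g ≫ eY.hom = eN.hom ≫ g') :
    (homMk f g hfA hgA : (of X : SpanCat A) ⟶ of Y) ≫ fwd eY.hom (mem_of_isIso _) =
      fwd eX.hom (mem_of_isIso _) ≫ homMk f' g' hfA' hgA' := by
  rw [fwd_eq_bwd_inv eX, fwd, bwd, homMk_comp (IsPullback.of_id_fst (f := g)),
    homMk_comp (IsPullback.of_id_snd (f := f'))]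
  refine homMk_sound eN ?_ (by simp [hg])
  simp [← reassoc_of% hf]

end Basic

section Monoidal

variable {C : Type u} [Category.{v} C] [MonoidalCategory C] {A : MorphismProperty C}
  [A.IsMonoidal]

/-- Tensor product of classes of spans, componentwise on representatives. -/
def tensor {X Y X' Y' : C} : Hom A X Y → Hom A X' Y' → Hom A (X ⊗ X') (Y ⊗ Y') :=
  Quot.map₂ (fun a b => ⟨a.apex ⊗ b.apex, a.l ⊗ₘ b.l, a.r ⊗ₘ b.r, A.tensorHom_mem _ _ a.wl b.wl,
      A.tensorHom_mem _ _ a.wr b.wr⟩)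
    (by
      rintro a b b' ⟨e⟩
      refine ⟨Span.mkIso (whiskerLeftIso a.apex (apexIso e)) ?_ ?_⟩
      · simp [← id_tensorHom]
      · simp [← id_tensorHom])
    (by
      rintro a a' b ⟨e⟩
      refine ⟨Span.mkIso (whiskerRightIso (apexIso e) b.apex) ?_ ?_⟩
      · simp [← tensorHom_id]
      · simp [← tensorHom_id])

variable [HasPullbacks C] [A.IsStableUnderBaseChange]

noncomputable instance : MonoidalCategoryStruct (SpanCat A) where
  tensorObj X Y := of (X.obj ⊗ Y.obj)
  tensorHom f g := tensor f g
  whiskerLeft X _ _ g := tensor (𝟙 X) g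
  whiskerRight f Y := tensor f (𝟙 Y)
  tensorUnit := of (𝟙_ C)
  associator X Y Z := ofIso (α_ X.obj Y.obj Z.obj)
  leftUnitor X := ofIso (λ_ X.obj)
  rightUnitor X := ofIso (ρ_ X.obj)

theorem tensor_obj (X Y : SpanCat A) : (X ⊗ Y).obj = X.obj ⊗ Y.obj := rfl

variable (A) in
theorem unit_obj : (𝟙_ (SpanCat A)).obj = 𝟙_ C := rfl

theorem homMk_tensor {X Y X' Y' : SpanCat A} {N N' : C} (f : N ⟶ X.obj) (g : N ⟶ Y.obj)
    (f' : N' ⟶ X'.obj) (g' : N' ⟶ Y'.obj) (hf : A f) (hg : A g) (hf' : A f') (hg' : A g') :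
    (homMk f g hf hg : X ⟶ Y) ⊗ₘ (homMk f' g' hf' hg' : X' ⟶ Y') =
      homMk (f ⊗ₘ f') (g ⊗ₘ g') (A.tensorHom_mem _ _ hf hf') (A.tensorHom_mem _ _ hg hg') := rfl

theorem fwd_tensor {X Y X' Y' : C} (f : X ⟶ Y) (f' : X' ⟶ Y') (hf : A f) (hf' : A f') :
    (fwd f hf : (of X : SpanCat A) ⟶ of Y) ⊗ₘ (fwd f' hf' : (of X' : SpanCat A) ⟶ of Y') =
      fwd (f ⊗ₘ f') (A.tensorHom_mem _ _ hf hf') := by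
  simp only [fwd]
  rw [homMk_tensor]
  exact homMk_congr (id_tensorHom_id _ _) rfl

theorem bwd_tensor {X Y X' Y' : C} (f : Y ⟶ X) (f' : Y' ⟶ X') (hf : A f) (hf' : A f') :
    (bwd f hf : (of X : SpanCat A) ⟶ of Y) ⊗ₘ (bwd f' hf' : (of X' : SpanCat A) ⟶ of Y') =
      bwd (f ⊗ₘ f') (A.tensorHom_mem _ _ hf hf') := by
  simp only [bwd]
  rw [homMk_tensor]
  exact homMk_congr rfl (id_tensorHom_id _ _)

theorem id_tensor_id (X Y : SpanCat A) : 𝟙 X ⊗ₘ 𝟙 Y = 𝟙 (X ⊗ Y) := by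
  simp only [id_eq]
  rw [homMk_tensor]
  exact homMk_congr (id_tensorHom_id _ _) (id_tensorHom_id _ _)

theorem fwd_whiskerRight {X Y : C} (f : X ⟶ Y) (hf : A f) (Z : SpanCat A) :
    fwd f hf ▷ Z = fwd (f ▷ Z.obj) (A.whiskerRight_mem _ hf _) :=
  (fwd_tensor f (𝟙 Z.obj) hf (A.id_mem _)).trans (fwd_congr (tensorHom_id _ _))

theorem whiskerLeft_fwd {X Y : C} (f : X ⟶ Y) (hf : A f) (Z : SpanCat A) :
    Z ◁ fwd f hf = fwd (Z.obj ◁ f) (A.whiskerLeft_mem _ _ hf) :=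
  (fwd_tensor (𝟙 Z.obj) f (A.id_mem _) hf).trans (fwd_congr (id_tensorHom _ _))

theorem bwd_whiskerRight {X Y : C} (f : Y ⟶ X) (hf : A f) (Z : SpanCat A) :
    (bwd f hf : (of X : SpanCat A) ⟶ of Y) ▷ Z = bwd (f ▷ Z.obj) (A.whiskerRight_mem _ hf _) :=
  (bwd_tensor f (𝟙 Z.obj) hf (A.id_mem _)).trans (homMk_congr (tensorHom_id _ _) rfl)

theorem whiskerLeft_bwd {X Y : C} (f : Y ⟶ X) (hf : A f) (Z : SpanCat A) :
    Z ◁ (bwd f hf : (of X : SpanCat A) ⟶ of Y) = bwd (Z.obj ◁ f) (A.whiskerLeft_mem _ _ hf) :=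
  (bwd_tensor (𝟙 Z.obj) f (A.id_mem _) hf).trans (homMk_congr (id_tensorHom _ _) rfl)

variable [TensorPreservesPullbacks A]

theorem tensor_comp {X₁ Y₁ Z₁ X₂ Y₂ Z₂ : SpanCat A} (f₁ : X₁ ⟶ Y₁) (f₂ : X₂ ⟶ Y₂)
    (g₁ : Y₁ ⟶ Z₁) (g₂ : Y₂ ⟶ Z₂) : (f₁ ⊗ₘ f₂) ≫ (g₁ ⊗ₘ g₂) = (f₁ ≫ g₁) ⊗ₘ (f₂ ≫ g₂) := by
  induction f₁ using hom_ind with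
  | h a b ha hb =>
  induction f₂ using hom_ind with
  | h c d hc hd =>
  induction g₁ using hom_ind with
  | h p q hp hq =>
  induction g₂ using hom_ind with
  | h r s hr hs =>
  have s₁ := IsPullback.of_hasPullback b p
  have s₂ := IsPullback.of_hasPullback d r
  rw [homMk_comp s₁, homMk_comp s₂, homMk_tensor, homMk_tensor, homMk_tensor,
    homMk_comp (TensorPreservesPullbacks.tensor_isPullback hb hp hd hr s₁ s₂)]
  exact homMk_congr (by simp) (by simp)

noncomputable instance monoidal : MonoidalCategory (SpanCat A) :=
  MonoidalCategory.ofTensorHom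
    (id_tensorHom_id := id_tensor_id)
    (id_tensorHom := fun _ _ _ _ => rfl)
    (tensorHom_id := fun _ _ => rfl)
    (tensorHom_comp_tensorHom := tensor_comp)
    (associator_naturality := by
      intro X₁ X₂ X₃ Y₁ Y₂ Y₃ f₁ f₂ f₃
      induction f₁ using hom_ind with
      | h a b =>
      induction f₂ using hom_ind with
      | h c d =>
      induction f₃ using hom_ind with
      | h p q =>
      simp only [homMk_tensor]
      exact homMk_naturality (α_ _ _ _) (α_ _ _ _) (α_ _ _ _) (by simp) (by simp))
    (leftUnitor_naturality := by
      intro X Y f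
      induction f using hom_ind with
      | h a b =>
      rw [id_eq, homMk_tensor]
      exact homMk_naturality (λ_ _) (λ_ _) (λ_ _) (by simp [unit_obj]) (by simp [unit_obj]))
    (rightUnitor_naturality := by
      intro X Y f
      induction f using hom_ind with
      | h a b =>
      rw [id_eq, homMk_tensor]
      exact homMk_naturality (ρ_ _) (ρ_ _) (ρ_ _) (by simp [unit_obj]) (by simp [unit_obj]))
    (pentagon := by
      intro X Y Z T
      change (fwd _ _ ⊗ₘ fwd (𝟙 _) (A.id_mem _)) ≫ fwd _ _ ≫ (fwd (𝟙 _) (A.id_mem _) ⊗ₘ fwd _ _) =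
        fwd _ _ ≫ fwd _ _
      simp only [fwd_tensor]
      simp only [fwd_comp]
      simp only [tensorHom_id, id_tensorHom]
      exact fwd_congr (MonoidalCategory.pentagon _ _ _ _))
    (triangle := by
      intro X Y
      change fwd _ _ ≫ (fwd (𝟙 _) (A.id_mem _) ⊗ₘ fwd _ _) = fwd _ _ ⊗ₘ fwd (𝟙 _) (A.id_mem _)
      simp only [fwd_tensor]
      simp only [fwd_comp]
      simp only [tensorHom_id, id_tensorHom]
      exact fwd_congr (MonoidalCategory.triangle _ _))

variable [SymmetricCategory C]

noncomputable instance symmetric : SymmetricCategory (SpanCat A) where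
  braiding X Y := ofIso (β_ X.obj Y.obj)
  braiding_naturality_right X Y Z f := by
    induction f using hom_ind with
    | h a b =>
    exact homMk_naturality (β_ _ _) (β_ _ _) (β_ _ _) (by simp) (by simp)
  braiding_naturality_left f Z := by
    induction f using hom_ind with
    | h a b =>
    exact homMk_naturality (β_ _ _) (β_ _ _) (β_ _ _) (by simp) (by simp)
  hexagon_forward X Y Z := by
    change fwd _ _ ≫ fwd _ _ ≫ fwd _ _ =
      (fwd _ _ ⊗ₘ fwd (𝟙 _) (A.id_mem _)) ≫ fwd _ _ ≫ (fwd (𝟙 _) (A.id_mem _) ⊗ₘ fwd _ _)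
    simp only [fwd_tensor]
    simp only [fwd_comp]
    simp only [tensorHom_id, id_tensorHom]
    exact fwd_congr (BraidedCategory.hexagon_forward _ _ _)
  hexagon_reverse X Y Z := by
    change fwd _ _ ≫ fwd _ _ ≫ fwd _ _ =
      (fwd (𝟙 _) (A.id_mem _) ⊗ₘ fwd _ _) ≫ fwd _ _ ≫ (fwd _ _ ⊗ₘ fwd (𝟙 _) (A.id_mem _))
    simp only [fwd_tensor]
    simp only [fwd_comp]
    simp only [tensorHom_id, id_tensorHom]
    exact fwd_congr (BraidedCategory.hexagon_reverse _ _ _)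
  symmetry X Y := by
    change fwd _ _ ≫ fwd _ _ = fwd (𝟙 _) (A.id_mem _)
    rw [fwd_comp]
    exact fwd_congr (SymmetricCategory.symmetry _ _)

end Monoidal
end SpanCat

/-! ### Zigzags -/

/-- Zigzags in `A`: finite sequences of morphisms of `A`, each pointing forwards or backwards. -/
inductive Zigzag {C : Type u} [Category.{v} C] (A : MorphismProperty C) : C → C → Type (max u v)
  | nil (X : C) : Zigzag A X X
  | fwd {X Y Z : C} (f : X ⟶ Y) (hf : A f) (w : Zigzag A Y Z) : Zigzag A X Z
  | bwd {X Y Z : C} (f : Y ⟶ X) (hf : A f) (w : Zigzag A Y Z) : Zigzag A X Z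

namespace Zigzag

/-- Concatenation of zigzags. -/
def append {C : Type u} [Category.{v} C] {A : MorphismProperty C} {X Y Z : C} :
    Zigzag A X Y → Zigzag A Y Z → Zigzag A X Z
  | .nil _, w' => w'
  | .fwd f hf w, w' => .fwd f hf (w.append w')
  | .bwd f hf w, w' => .bwd f hf (w.append w')

/-- The relations defining the category `A +_{|A|} Aᵒᵖ` (at the head of a zigzag): consecutive
morphisms of `A` pointing in the same direction are composed, and identities are removed. -/
inductive Amalgam {C : Type u} [Category.{v} C] {A : MorphismProperty C} :
    ∀ {X Y : C}, Zigzag A X Y → Zigzag A X Y → Prop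
  | fwd_id {X Y : C} (h : A (𝟙 X)) (w : Zigzag A X Y) : Amalgam (.fwd (𝟙 X) h w) w
  | bwd_id {X Y : C} (h : A (𝟙 X)) (w : Zigzag A X Y) : Amalgam (.bwd (𝟙 X) h w) w
  | fwd_fwd {X Y Z T : C} (f : X ⟶ Y) (g : Y ⟶ Z) (hf : A f) (hg : A g) (h : A (f ≫ g))
      (w : Zigzag A Z T) : Amalgam (.fwd f hf (.fwd g hg w)) (.fwd (f ≫ g) h w)
  | bwd_bwd {X Y Z T : C} (f : Y ⟶ X) (g : Z ⟶ Y) (hf : A f) (hg : A g) (h : A (g ≫ f))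
      (w : Zigzag A Z T) : Amalgam (.bwd f hf (.bwd g hg w)) (.bwd (g ≫ f) h w)

end Zigzag

/-- The structural isomorphisms of a symmetric monoidal category. -/
inductive IsStructural {C : Type u} [Category.{v} C] [MonoidalCategory C] [SymmetricCategory C] :
    ∀ {X Y : C}, (X ≅ Y) → Prop
  | associator (X Y Z : C) : IsStructural (α_ X Y Z)
  | leftUnitor (X : C) : IsStructural (λ_ X)
  | rightUnitor (X : C) : IsStructural (ρ_ X)
  | braiding (X Y : C) : IsStructural (β_ X Y)
  | whiskerLeft (X : C) {Y Z : C} (e : Y ≅ Z) : IsStructural e → IsStructural (whiskerLeftIso X e)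
  | whiskerRight {Y Z : C} (e : Y ≅ Z) (X : C) : IsStructural e →
      IsStructural (whiskerRightIso e X)

namespace Zigzag

/-- The further relations (at the head of a zigzag) that make zigzags a symmetric monoidal category
into which `A` and `Aᵒᵖ` map by strict symmetric monoidal functors: a forward and a backward
morphism acting on different tensor factors commute, and each structural isomorphism, pointing
forwards, agrees with its inverse, pointing backwards. -/
inductive Tensorial {C : Type u} [Category.{v} C] [MonoidalCategory C] [SymmetricCategory C]
    {A : MorphismProperty C} : ∀ {X Y : C}, Zigzag A X Y → Zigzag A X Y → Prop
  | fwd_bwd {X X' Y Y' T : C} (f : X ⟶ X') (g : Y ⟶ Y') (h₁ : A (f ▷ Y')) (h₂ : A (X' ◁ g))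
      (h₃ : A (X ◁ g)) (h₄ : A (f ▷ Y)) (hf : A f) (hg : A g) (w : Zigzag A (X' ⊗ Y) T) :
      Tensorial (.fwd (f ▷ Y') h₁ (.bwd (X' ◁ g) h₂ w)) (.bwd (X ◁ g) h₃ (.fwd (f ▷ Y) h₄ w))
  | bwd_fwd {X X' Y Y' T : C} (f : X ⟶ X') (g : Y ⟶ Y') (h₁ : A (f ▷ Y)) (h₂ : A (X ◁ g))
      (h₃ : A (X' ◁ g)) (h₄ : A (f ▷ Y')) (hf : A f) (hg : A g) (w : Zigzag A (X ⊗ Y') T) :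
      Tensorial (.bwd (f ▷ Y) h₁ (.fwd (X ◁ g) h₂ w)) (.fwd (X' ◁ g) h₃ (.bwd (f ▷ Y') h₄ w))
  | structural {X Y T : C} (e : X ≅ Y) (he : IsStructural e) (h : A e.hom) (h' : A e.inv)
      (w : Zigzag A Y T) : Tensorial (.fwd e.hom h w) (.bwd e.inv h' w)

/-- The defining relations, applied anywhere in a zigzag. -/
inductive Step {C : Type u} [Category.{v} C] [MonoidalCategory C] [SymmetricCategory C]
    {A : MorphismProperty C} : ∀ {X Y : C}, Zigzag A X Y → Zigzag A X Y → Prop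
  | amalgam {X Y : C} {w w' : Zigzag A X Y} : Amalgam w w' → Step w w'
  | tensorial {X Y : C} {w w' : Zigzag A X Y} : Tensorial w w' → Step w w'
  | fwd {X Y Z : C} (f : X ⟶ Y) (hf : A f) {w w' : Zigzag A Y Z} :
      Step w w' → Step (.fwd f hf w) (.fwd f hf w')
  | bwd {X Y Z : C} (f : Y ⟶ X) (hf : A f) {w w' : Zigzag A Y Z} :
      Step w w' → Step (.bwd f hf w) (.bwd f hf w')

section

variable {C : Type u} [Category.{v} C] {A : MorphismProperty C}

theorem append_nil {X Y : C} (w : Zigzag A X Y) : w.append (.nil Y) = w := by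
  induction w with
  | nil => rfl
  | fwd f hf w ih => simp [append, ih]
  | bwd f hf w ih => simp [append, ih]

theorem append_assoc {X Y Z T : C} (w : Zigzag A X Y) (w' : Zigzag A Y Z) (w'' : Zigzag A Z T) :
    (w.append w').append w'' = w.append (w'.append w'') := by
  induction w with
  | nil => rfl
  | fwd f hf w ih => simp [append, ih]
  | bwd f hf w ih => simp [append, ih]

variable [MonoidalCategory C] [SymmetricCategory C]

theorem Step.append_left {X Y Z : C} (w : Zigzag A X Y) {w' w'' : Zigzag A Y Z}
    (h : Step w' w'') : Step (w.append w') (w.append w'') := by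
  induction w with
  | nil => exact h
  | fwd f hf w ih => exact .fwd f hf (ih h)
  | bwd f hf w ih => exact .bwd f hf (ih h)

theorem Step.append_right {X Y Z : C} {w w' : Zigzag A X Y} (w'' : Zigzag A Y Z)
    (h : Step w w') : Step (w.append w'') (w'.append w'') := by
  induction h with
  | amalgam h =>
    refine .amalgam ?_
    cases h with
    | fwd_id h w => exact .fwd_id h _
    | bwd_id h w => exact .bwd_id h _
    | fwd_fwd f g hf hg h w => exact .fwd_fwd f g hf hg h _
    | bwd_bwd f g hf hg h w => exact .bwd_bwd f g hf hg h _
  | tensorial h =>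
    refine .tensorial ?_
    cases h with
    | fwd_bwd f g h₁ h₂ h₃ h₄ hf hg w => exact .fwd_bwd f g h₁ h₂ h₃ h₄ hf hg _
    | bwd_fwd f g h₁ h₂ h₃ h₄ hf hg w => exact .bwd_fwd f g h₁ h₂ h₃ h₄ hf hg _
    | structural e he h h' w => exact .structural e he h h' _
  | fwd f hf _ ih => exact .fwd f hf (ih _)
  | bwd f hf _ ih => exact .bwd f hf (ih _)

end

end Zigzag

/-- The objects of the category of zigzags in `A`. -/
@[ext]
structure ZigzagCat {C : Type u} [Category.{v} C] (A : MorphismProperty C) where of ::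
  obj : C

namespace ZigzagCat

section Basic

variable {C : Type u} [Category.{v} C] [MonoidalCategory C] [SymmetricCategory C]
  {A : MorphismProperty C}

/-- Zigzags modulo the defining relations, composed by concatenation. -/
instance category : Category.{max u v} (ZigzagCat A) where
  Hom X Y := Quot (Zigzag.Step (A := A) (X := X.obj) (Y := Y.obj))
  id X := Quot.mk _ (.nil X.obj)
  comp := Quot.map₂ Zigzag.append (fun w _ _ h => .append_left w h) (fun _ _ w h => .append_right w h)
  id_comp := by rintro X Y ⟨w⟩; rfl
  comp_id := by rintro X Y ⟨w⟩; exact congrArg (Quot.mk _) w.append_nil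
  assoc := by rintro X Y Z T ⟨w⟩ ⟨w'⟩ ⟨w''⟩; exact congrArg (Quot.mk _) (w.append_assoc w' w'')

/-- A morphism of `A` as a forward zigzag. -/
def fwd {X Y : C} (f : X ⟶ Y) (hf : A f) : (of X : ZigzagCat A) ⟶ of Y :=
  Quot.mk _ (.fwd f hf (.nil Y))

/-- A morphism of `A` as a backward zigzag. -/
def bwd {X Y : C} (f : Y ⟶ X) (hf : A f) : (of X : ZigzagCat A) ⟶ of Y :=
  Quot.mk _ (.bwd f hf (.nil Y))

theorem hom_ind {P : ∀ {X Y : ZigzagCat A}, (X ⟶ Y) → Prop} (id : ∀ X, P (𝟙 X))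
    (fwd_comp : ∀ {X Y : C} {Z : ZigzagCat A} (f : X ⟶ Y) (hf : A f) (w : of Y ⟶ Z), P w →
      P (fwd f hf ≫ w))
    (bwd_comp : ∀ {X Y : C} {Z : ZigzagCat A} (f : Y ⟶ X) (hf : A f) (w : of Y ⟶ Z), P w →
      P (bwd f hf ≫ w))
    {X Y : ZigzagCat A} (a : X ⟶ Y) : P a := by
  obtain ⟨w⟩ := a
  have key : ∀ {X Y : C} (w : Zigzag A X Y),
      P (X := of X) (Y := of Y) (Quot.mk _ w) := by
    intro X Y w
    induction w with
    | nil X => exact id (of X)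
    | fwd f hf w ih => exact fwd_comp f hf (Quot.mk _ w) ih
    | bwd f hf w ih => exact bwd_comp f hf (Quot.mk _ w) ih
  exact key w

theorem fwd_id (X : C) (h : A (𝟙 X)) : fwd (𝟙 X) h = 𝟙 (of X : ZigzagCat A) :=
  Quot.sound (.amalgam (.fwd_id h _))

theorem bwd_id (X : C) (h : A (𝟙 X)) : bwd (𝟙 X) h = 𝟙 (of X : ZigzagCat A) :=
  Quot.sound (.amalgam (.bwd_id h _))

theorem fwd_comp {X Y Z : C} (f : X ⟶ Y) (g : Y ⟶ Z) (hf : A f) (hg : A g) (h : A (f ≫ g)) :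
    (fwd f hf : (of X : ZigzagCat A) ⟶ of Y) ≫ fwd g hg = fwd (f ≫ g) h :=
  Quot.sound (.amalgam (.fwd_fwd f g hf hg h _))

theorem bwd_comp {X Y Z : C} (f : Y ⟶ X) (g : Z ⟶ Y) (hf : A f) (hg : A g) (h : A (g ≫ f)) :
    (bwd f hf : (of X : ZigzagCat A) ⟶ of Y) ≫ bwd g hg = bwd (g ≫ f) h :=
  Quot.sound (.amalgam (.bwd_bwd f g hf hg h _))

theorem fwd_bwd {X X' Y Y' : C} (f : X ⟶ X') (g : Y ⟶ Y') (h₁ : A (f ▷ Y')) (h₂ : A (X' ◁ g))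
    (h₃ : A (X ◁ g)) (h₄ : A (f ▷ Y)) (hf : A f) (hg : A g) :
    (fwd (f ▷ Y') h₁ : (of _ : ZigzagCat A) ⟶ of _) ≫ bwd (X' ◁ g) h₂ =
      bwd (X ◁ g) h₃ ≫ fwd (f ▷ Y) h₄ :=
  Quot.sound (.tensorial (.fwd_bwd f g h₁ h₂ h₃ h₄ hf hg _))

theorem bwd_fwd {X X' Y Y' : C} (f : X ⟶ X') (g : Y ⟶ Y') (h₁ : A (f ▷ Y)) (h₂ : A (X ◁ g))
    (h₃ : A (X' ◁ g)) (h₄ : A (f ▷ Y')) (hf : A f) (hg : A g) :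
    (bwd (f ▷ Y) h₁ : (of _ : ZigzagCat A) ⟶ of _) ≫ fwd (X ◁ g) h₂ =
      fwd (X' ◁ g) h₃ ≫ bwd (f ▷ Y') h₄ :=
  Quot.sound (.tensorial (.bwd_fwd f g h₁ h₂ h₃ h₄ hf hg _))

theorem structural {X Y : C} (e : X ≅ Y) (he : IsStructural e) (h : A e.hom) (h' : A e.inv) :
    (fwd e.hom h : (of X : ZigzagCat A) ⟶ of Y) = bwd e.inv h' :=
  Quot.sound (.tensorial (.structural e he h h' _))

theorem fwd_congr {X Y : C} {f f' : X ⟶ Y} {hf : A f} {hf' : A f'} (h : f = f') :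
    (fwd f hf : (of X : ZigzagCat A) ⟶ of Y) = fwd f' hf' := by
  subst h; rfl

theorem bwd_congr {X Y : C} {f f' : Y ⟶ X} {hf : A f} {hf' : A f'} (h : f = f') :
    (bwd f hf : (of X : ZigzagCat A) ⟶ of Y) = bwd f' hf' := by
  subst h; rfl

end Basic

/-- Interpretations of zigzags in `D` that respect the defining relations. -/
structure LiftData {C : Type u} [Category.{v} C] [MonoidalCategory C] [SymmetricCategory C]
    (A : MorphismProperty C) (D : Type*) [Category* D] where
  obj : C → D
  fwd : ∀ {X Y : C} (f : X ⟶ Y), A f → (obj X ⟶ obj Y)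
  bwd : ∀ {X Y : C} (f : Y ⟶ X), A f → (obj X ⟶ obj Y)
  fwd_id : ∀ (X : C) (h : A (𝟙 X)), fwd (𝟙 X) h = 𝟙 (obj X)
  bwd_id : ∀ (X : C) (h : A (𝟙 X)), bwd (𝟙 X) h = 𝟙 (obj X)
  fwd_comp : ∀ {X Y Z : C} (f : X ⟶ Y) (g : Y ⟶ Z) (hf : A f) (hg : A g) (h : A (f ≫ g)),
    fwd f hf ≫ fwd g hg = fwd (f ≫ g) h
  bwd_comp : ∀ {X Y Z : C} (f : Y ⟶ X) (g : Z ⟶ Y) (hf : A f) (hg : A g) (h : A (g ≫ f)),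
    bwd f hf ≫ bwd g hg = bwd (g ≫ f) h
  fwd_bwd : ∀ {X X' Y Y' : C} (f : X ⟶ X') (g : Y ⟶ Y') (h₁ : A (f ▷ Y')) (h₂ : A (X' ◁ g))
    (h₃ : A (X ◁ g)) (h₄ : A (f ▷ Y)), A f → A g →
    fwd (f ▷ Y') h₁ ≫ bwd (X' ◁ g) h₂ = bwd (X ◁ g) h₃ ≫ fwd (f ▷ Y) h₄
  bwd_fwd : ∀ {X X' Y Y' : C} (f : X ⟶ X') (g : Y ⟶ Y') (h₁ : A (f ▷ Y)) (h₂ : A (X ◁ g))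
    (h₃ : A (X' ◁ g)) (h₄ : A (f ▷ Y')), A f → A g →
    bwd (f ▷ Y) h₁ ≫ fwd (X ◁ g) h₂ = fwd (X' ◁ g) h₃ ≫ bwd (f ▷ Y') h₄
  structural : ∀ {X Y : C} (e : X ≅ Y), IsStructural e → ∀ (h : A e.hom) (h' : A e.inv),
    fwd e.hom h = bwd e.inv h'

namespace LiftData

variable {C : Type u} [Category.{v} C] [MonoidalCategory C] [SymmetricCategory C]
  {A : MorphismProperty C} {D : Type*} [Category* D] (d : LiftData A D)

/-- The composite in `D` of the interpretations of the members of a zigzag. -/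
def eval {X Y : C} : Zigzag A X Y → (d.obj X ⟶ d.obj Y)
  | .nil X => 𝟙 (d.obj X)
  | .fwd f hf w => d.fwd f hf ≫ eval w
  | .bwd f hf w => d.bwd f hf ≫ eval w

theorem eval_append {X Y Z : C} (w : Zigzag A X Y) (w' : Zigzag A Y Z) :
    d.eval (w.append w') = d.eval w ≫ d.eval w' := by
  induction w with
  | nil => simp [Zigzag.append, eval]
  | fwd f hf w ih => simp [Zigzag.append, eval, ih]
  | bwd f hf w ih => simp [Zigzag.append, eval, ih]

theorem eval_step {X Y : C} {w w' : Zigzag A X Y} (h : Zigzag.Step w w') :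
    d.eval w = d.eval w' := by
  induction h with
  | amalgam h =>
    cases h with
    | fwd_id h w => simp [eval, d.fwd_id]
    | bwd_id h w => simp [eval, d.bwd_id]
    | fwd_fwd f g hf hg h w => simp [eval, ← d.fwd_comp f g hf hg]
    | bwd_bwd f g hf hg h w => simp [eval, ← d.bwd_comp f g hf hg]
  | tensorial h =>
    cases h with
    | fwd_bwd f g h₁ h₂ h₃ h₄ hf hg w =>
      simp only [eval, reassoc_of% (d.fwd_bwd f g h₁ h₂ h₃ h₄ hf hg)]
    | bwd_fwd f g h₁ h₂ h₃ h₄ hf hg w =>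
      simp only [eval, reassoc_of% (d.bwd_fwd f g h₁ h₂ h₃ h₄ hf hg)]
    | structural e he h h' w => simp only [eval, d.structural e he h h']
  | fwd f hf _ ih => simp only [eval, ih]
  | bwd f hf _ ih => simp only [eval, ih]

/-- The functor on zigzags determined by an interpretation. -/
def functor : ZigzagCat A ⥤ D where
  obj X := d.obj X.obj
  map := Quot.lift d.eval (fun _ _ h => d.eval_step h)
  map_id _ := rfl
  map_comp := by rintro X Y Z ⟨w⟩ ⟨w'⟩; exact d.eval_append w w'

theorem functor_fwd {X Y : C} (f : X ⟶ Y) (hf : A f) :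
    d.functor.map (ZigzagCat.fwd f hf) = d.fwd f hf :=
  Category.comp_id _

theorem functor_bwd {X Y : C} (f : Y ⟶ X) (hf : A f) :
    d.functor.map (ZigzagCat.bwd f hf) = d.bwd f hf :=
  Category.comp_id _

end LiftData

section Monoidal

variable {C : Type u} [Category.{v} C] [MonoidalCategory C] [SymmetricCategory C]
  {A : MorphismProperty C}

/-- A family of morphisms that is natural with respect to the morphisms of `A`, forwards and
backwards, is natural with respect to zigzags. -/
theorem naturality_of_generators {D : Type*} [Category* D] {F G : ZigzagCat A ⥤ D}
    (η : ∀ X : ZigzagCat A, F.obj X ⟶ G.obj X)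
    (h₁ : ∀ {X Y : C} (f : X ⟶ Y) (hf : A f),
      F.map (fwd f hf) ≫ η (of Y) = η (of X) ≫ G.map (fwd f hf))
    (h₂ : ∀ {X Y : C} (f : Y ⟶ X) (hf : A f),
      F.map (bwd f hf) ≫ η (of Y) = η (of X) ≫ G.map (bwd f hf))
    {X Y : ZigzagCat A} (a : X ⟶ Y) : F.map a ≫ η Y = η X ≫ G.map a := by
  induction a using hom_ind with
  | id X => simp
  | fwd_comp f hf w ih => simp [ih, reassoc_of% (h₁ f hf)]
  | bwd_comp f hf w ih => simp [ih, reassoc_of% (h₂ f hf)]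

variable [A.IsMonoidal] [A.IsStableUnderBaseChange]

/-- A structural isomorphism as an isomorphism of zigzags. -/
@[simps]
def ofIso {X Y : C} (e : X ≅ Y) : (of X : ZigzagCat A) ≅ of Y where
  hom := fwd e.hom (SpanCat.mem_of_isIso _)
  inv := fwd e.inv (SpanCat.mem_of_isIso _)
  hom_inv_id := by
    rw [fwd_comp (h := SpanCat.mem_of_isIso _), ← fwd_id _ (A.id_mem _)]
    exact fwd_congr e.hom_inv_id
  inv_hom_id := by
    rw [fwd_comp (h := SpanCat.mem_of_isIso _), ← fwd_id _ (A.id_mem _)]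
    exact fwd_congr e.inv_hom_id

theorem structural_hom {X Y : C} {e : X ≅ Y} (he : IsStructural e) :
    (ofIso e : (of X : ZigzagCat A) ≅ of Y).hom = bwd e.inv (SpanCat.mem_of_isIso _) :=
  structural e he _ _

theorem structural_inv {X Y : C} {e : X ≅ Y} (he : IsStructural e) :
    (ofIso e : (of X : ZigzagCat A) ≅ of Y).inv = bwd e.hom (SpanCat.mem_of_isIso _) := by
  rw [← cancel_epi (ofIso e : (of X : ZigzagCat A) ≅ of Y).hom, Iso.hom_inv_id, structural_hom he,
    bwd_comp (h := SpanCat.mem_of_isIso _), ← bwd_id _ (A.id_mem _)]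
  exact bwd_congr e.hom_inv_id.symm

theorem fwd_naturality {X Y X' Y' : C} {f : X ⟶ Y} {f' : X' ⟶ Y'} (hf : A f) (hf' : A f')
    (eX : X ≅ X') (eY : Y ≅ Y') (h : f ≫ eY.hom = eX.hom ≫ f') :
    (fwd f hf : (of X : ZigzagCat A) ⟶ of Y) ≫ (ofIso eY).hom = (ofIso eX).hom ≫ fwd f' hf' := by
  simp only [ofIso_hom]
  rw [fwd_comp (h := A.comp_mem _ _ hf (SpanCat.mem_of_isIso _)),
    fwd_comp (h := A.comp_mem _ _ (SpanCat.mem_of_isIso _) hf')]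
  exact fwd_congr h

theorem bwd_naturality {X Y X' Y' : C} {f : Y ⟶ X} {f' : Y' ⟶ X'} (hf : A f) (hf' : A f')
    {eX : X ≅ X'} {eY : Y ≅ Y'} (hX : IsStructural eX) (hY : IsStructural eY)
    (h : f ≫ eX.hom = eY.hom ≫ f') :
    (bwd f hf : (of X : ZigzagCat A) ⟶ of Y) ≫ (ofIso eY).hom = (ofIso eX).hom ≫ bwd f' hf' := by
  rw [structural_hom hX, structural_hom hY,
    bwd_comp (h := A.comp_mem _ _ (SpanCat.mem_of_isIso _) hf),
    bwd_comp (h := A.comp_mem _ _ hf' (SpanCat.mem_of_isIso _))]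
  exact bwd_congr (by rw [Iso.inv_comp_eq, ← reassoc_of% h, Iso.hom_inv_id, Category.comp_id])

theorem fwd_eq_conj {X Y X' Y' : C} {f : X ⟶ Y} {f' : X' ⟶ Y'} (hf : A f) (hf' : A f')
    (eX : X ≅ X') (eY : Y ≅ Y') (h : f ≫ eY.hom = eX.hom ≫ f') :
    (fwd f hf : (of X : ZigzagCat A) ⟶ of Y) =
      (ofIso eX).hom ≫ fwd f' hf' ≫ (ofIso eY).inv := by
  rw [← Category.assoc, ← fwd_naturality hf hf' eX eY h, Category.assoc, Iso.hom_inv_id,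
    Category.comp_id]

theorem bwd_eq_conj {X Y X' Y' : C} {f : Y ⟶ X} {f' : Y' ⟶ X'} (hf : A f) (hf' : A f')
    {eX : X ≅ X'} {eY : Y ≅ Y'} (hX : IsStructural eX) (hY : IsStructural eY)
    (h : f ≫ eX.hom = eY.hom ≫ f') :
    (bwd f hf : (of X : ZigzagCat A) ⟶ of Y) =
      (ofIso eX).hom ≫ bwd f' hf' ≫ (ofIso eY).inv := by
  rw [← Category.assoc, ← bwd_naturality hf hf' hX hY h, Category.assoc, Iso.hom_inv_id,
    Category.comp_id]

theorem fwd_eq_conj' {X Y X' Y' : C} {f : X ⟶ Y} {f' : X' ⟶ Y'} (hf : A f) (hf' : A f')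
    (eX : X' ≅ X) (eY : Y' ≅ Y) (h : f' ≫ eY.hom = eX.hom ≫ f) :
    (fwd f hf : (of X : ZigzagCat A) ⟶ of Y) =
      (ofIso eX).inv ≫ fwd f' hf' ≫ (ofIso eY).hom := by
  rw [fwd_naturality hf' hf eX eY h, Iso.inv_hom_id_assoc]

theorem bwd_eq_conj' {X Y X' Y' : C} {f : Y ⟶ X} {f' : Y' ⟶ X'} (hf : A f) (hf' : A f')
    {eX : X' ≅ X} {eY : Y' ≅ Y} (hX : IsStructural eX) (hY : IsStructural eY)
    (h : f' ≫ eX.hom = eY.hom ≫ f) :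
    (bwd f hf : (of X : ZigzagCat A) ⟶ of Y) =
      (ofIso eX).inv ≫ bwd f' hf' ≫ (ofIso eY).hom := by
  rw [bwd_naturality hf' hf hX hY h, Iso.inv_hom_id_assoc]

/-- Tensoring zigzags with an object on the left. -/
def whiskerLeftData (W : C) : LiftData A (ZigzagCat A) where
  obj X := of (W ⊗ X)
  fwd f hf := fwd (W ◁ f) (A.whiskerLeft_mem _ _ hf)
  bwd f hf := bwd (W ◁ f) (A.whiskerLeft_mem _ _ hf)
  fwd_id X _ := by rw [← fwd_id _ (A.id_mem _)]; exact fwd_congr (by simp)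
  bwd_id X _ := by rw [← bwd_id _ (A.id_mem _)]; exact bwd_congr (by simp)
  fwd_comp f g hf hg h := by
    rw [fwd_comp (h := A.comp_mem _ _ (A.whiskerLeft_mem _ _ hf) (A.whiskerLeft_mem _ _ hg))]
    exact fwd_congr (by simp)
  bwd_comp f g hf hg h := by
    rw [bwd_comp (h := A.comp_mem _ _ (A.whiskerLeft_mem _ _ hg) (A.whiskerLeft_mem _ _ hf))]
    exact bwd_congr (by simp)
  fwd_bwd {X X' Y Y'} f g h₁ h₂ h₃ h₄ hf hg := by
    have hWf := A.whiskerLeft_mem W _ hf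
    rw [fwd_eq_conj' _ (A.whiskerRight_mem _ hWf Y') (α_ W X Y') (α_ W X' Y') (by simp),
      fwd_eq_conj' _ (A.whiskerRight_mem _ hWf Y) (α_ W X Y) (α_ W X' Y) (by simp),
      bwd_eq_conj' _ (A.whiskerLeft_mem (W ⊗ X') _ hg) (.associator W X' Y')
        (.associator W X' Y) (by simp),
      bwd_eq_conj' _ (A.whiskerLeft_mem (W ⊗ X) _ hg) (.associator W X Y')
        (.associator W X Y) (by simp)]
    simp only [Category.assoc, Iso.hom_inv_id_assoc]
    rw [reassoc_of% (fwd_bwd (W ◁ f) g _ _ (A.whiskerLeft_mem _ _ hg)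
      (A.whiskerRight_mem _ hWf _) hWf hg)]
  bwd_fwd {X X' Y Y'} f g h₁ h₂ h₃ h₄ hf hg := by
    have hWf := A.whiskerLeft_mem W _ hf
    rw [bwd_eq_conj' _ (A.whiskerRight_mem _ hWf Y') (.associator W X' Y') (.associator W X Y')
        (by simp),
      bwd_eq_conj' _ (A.whiskerRight_mem _ hWf Y) (.associator W X' Y) (.associator W X Y)
        (by simp),
      fwd_eq_conj' _ (A.whiskerLeft_mem (W ⊗ X') _ hg) (α_ W X' Y) (α_ W X' Y') (by simp),
      fwd_eq_conj' _ (A.whiskerLeft_mem (W ⊗ X) _ hg) (α_ W X Y) (α_ W X Y') (by simp)]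
    simp only [Category.assoc, Iso.hom_inv_id_assoc]
    rw [reassoc_of% (bwd_fwd (W ◁ f) g _ _ (A.whiskerLeft_mem _ _ hg)
      (A.whiskerRight_mem _ hWf _) hWf hg)]
  structural e he h h' := structural (whiskerLeftIso W e) (.whiskerLeft W e he) _ _

/-- Tensoring zigzags with an object on the right. -/
def whiskerRightData (W : C) : LiftData A (ZigzagCat A) where
  obj X := of (X ⊗ W)
  fwd f hf := fwd (f ▷ W) (A.whiskerRight_mem _ hf _)
  bwd f hf := bwd (f ▷ W) (A.whiskerRight_mem _ hf _)
  fwd_id X _ := by rw [← fwd_id _ (A.id_mem _)]; exact fwd_congr (by simp)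
  bwd_id X _ := by rw [← bwd_id _ (A.id_mem _)]; exact bwd_congr (by simp)
  fwd_comp f g hf hg h := by
    rw [fwd_comp (h := A.comp_mem _ _ (A.whiskerRight_mem _ hf _) (A.whiskerRight_mem _ hg _))]
    exact fwd_congr (by simp)
  bwd_comp f g hf hg h := by
    rw [bwd_comp (h := A.comp_mem _ _ (A.whiskerRight_mem _ hg _) (A.whiskerRight_mem _ hf _))]
    exact bwd_congr (by simp)
  fwd_bwd {X X' Y Y'} f g h₁ h₂ h₃ h₄ hf hg := by
    have hgW := A.whiskerRight_mem _ hg W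
    rw [fwd_eq_conj _ (A.whiskerRight_mem _ hf (Y' ⊗ W)) (α_ X Y' W) (α_ X' Y' W) (by simp),
      fwd_eq_conj _ (A.whiskerRight_mem _ hf (Y ⊗ W)) (α_ X Y W) (α_ X' Y W) (by simp),
      bwd_eq_conj _ (A.whiskerLeft_mem X' _ hgW) (.associator X' Y' W)
        (.associator X' Y W) (by simp),
      bwd_eq_conj _ (A.whiskerLeft_mem X _ hgW) (.associator X Y' W)
        (.associator X Y W) (by simp)]
    simp only [Category.assoc, Iso.inv_hom_id_assoc]
    rw [reassoc_of% (fwd_bwd f (g ▷ W) _ _ (A.whiskerLeft_mem _ _ hgW)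
      (A.whiskerRight_mem _ hf _) hf hgW)]
  bwd_fwd {X X' Y Y'} f g h₁ h₂ h₃ h₄ hf hg := by
    have hgW := A.whiskerRight_mem _ hg W
    rw [bwd_eq_conj _ (A.whiskerRight_mem _ hf (Y' ⊗ W)) (.associator X' Y' W)
        (.associator X Y' W) (by simp),
      bwd_eq_conj _ (A.whiskerRight_mem _ hf (Y ⊗ W)) (.associator X' Y W)
        (.associator X Y W) (by simp),
      fwd_eq_conj _ (A.whiskerLeft_mem X' _ hgW) (α_ X' Y W) (α_ X' Y' W) (by simp),
      fwd_eq_conj _ (A.whiskerLeft_mem X _ hgW) (α_ X Y W) (α_ X Y' W) (by simp)]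
    simp only [Category.assoc, Iso.inv_hom_id_assoc]
    rw [reassoc_of% (bwd_fwd f (g ▷ W) _ _ (A.whiskerLeft_mem _ _ hgW)
      (A.whiskerRight_mem _ hf _) hf hgW)]
  structural e he h h' := structural (whiskerRightIso e W) (.whiskerRight e W he) _ _

instance : MonoidalCategoryStruct (ZigzagCat A) where
  tensorObj X Y := of (X.obj ⊗ Y.obj)
  whiskerLeft X _ _ g := (whiskerLeftData X.obj).functor.map g
  whiskerRight f Y := (whiskerRightData Y.obj).functor.map f
  tensorUnit := of (𝟙_ C)
  associator X Y Z := ofIso (α_ X.obj Y.obj Z.obj)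
  leftUnitor X := ofIso (λ_ X.obj)
  rightUnitor X := ofIso (ρ_ X.obj)

theorem whiskerLeft_fwd (W : ZigzagCat A) {X Y : C} (f : X ⟶ Y) (hf : A f) :
    W ◁ fwd f hf = fwd (W.obj ◁ f) (A.whiskerLeft_mem _ _ hf) :=
  (whiskerLeftData W.obj).functor_fwd f hf

theorem whiskerLeft_bwd (W : ZigzagCat A) {X Y : C} (f : Y ⟶ X) (hf : A f) :
    W ◁ (bwd f hf : (of X : ZigzagCat A) ⟶ of Y) = bwd (W.obj ◁ f) (A.whiskerLeft_mem _ _ hf) :=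
  (whiskerLeftData W.obj).functor_bwd f hf

theorem fwd_whiskerRight (W : ZigzagCat A) {X Y : C} (f : X ⟶ Y) (hf : A f) :
    fwd f hf ▷ W = fwd (f ▷ W.obj) (A.whiskerRight_mem _ hf _) :=
  (whiskerRightData W.obj).functor_fwd f hf

theorem bwd_whiskerRight (W : ZigzagCat A) {X Y : C} (f : Y ⟶ X) (hf : A f) :
    (bwd f hf : (of X : ZigzagCat A) ⟶ of Y) ▷ W = bwd (f ▷ W.obj) (A.whiskerRight_mem _ hf _) :=
  (whiskerRightData W.obj).functor_bwd f hf

theorem whiskerLeft_comp' (W : ZigzagCat A) {X Y Z : ZigzagCat A} (f : X ⟶ Y) (g : Y ⟶ Z) :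
    W ◁ (f ≫ g) = W ◁ f ≫ W ◁ g :=
  (whiskerLeftData W.obj).functor.map_comp f g

theorem comp_whiskerRight' (W : ZigzagCat A) {X Y Z : ZigzagCat A} (f : X ⟶ Y) (g : Y ⟶ Z) :
    (f ≫ g) ▷ W = f ▷ W ≫ g ▷ W :=
  (whiskerRightData W.obj).functor.map_comp f g

theorem whiskerLeft_id' (W X : ZigzagCat A) : W ◁ 𝟙 X = 𝟙 (W ⊗ X) :=
  (whiskerLeftData W.obj).functor.map_id X

theorem id_whiskerRight' (W X : ZigzagCat A) : 𝟙 X ▷ W = 𝟙 (X ⊗ W) :=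
  (whiskerRightData W.obj).functor.map_id X

theorem exchange {X X' Y Y' : ZigzagCat A} (f : X ⟶ X') (g : Y ⟶ Y') :
    f ▷ Y ≫ X' ◁ g = X ◁ g ≫ f ▷ Y' := by
  refine (naturality_of_generators (F := (whiskerLeftData X.obj).functor)
    (G := (whiskerLeftData X'.obj).functor) (fun Z => f ▷ Z) ?_ ?_ g).symm
  · intro Y Y' g hg
    refine (naturality_of_generators (F := (whiskerRightData Y).functor)
      (G := (whiskerRightData Y').functor) (fun Z => Z ◁ fwd g hg) ?_ ?_ f).symm
    · intro X X' f hf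
      rw [whiskerLeft_fwd, whiskerLeft_fwd, LiftData.functor_fwd, LiftData.functor_fwd]
      change fwd (f ▷ Y) _ ≫ fwd (X' ◁ g) _ = fwd (X ◁ g) _ ≫ fwd (f ▷ Y') _
      rw [fwd_comp, fwd_comp]
      · exact fwd_congr (whisker_exchange _ _).symm
      · exact A.comp_mem _ _ (A.whiskerLeft_mem _ _ hg) (A.whiskerRight_mem _ hf _)
      · exact A.comp_mem _ _ (A.whiskerRight_mem _ hf _) (A.whiskerLeft_mem _ _ hg)
    · intro X X' f hf
      rw [whiskerLeft_fwd, whiskerLeft_fwd, LiftData.functor_bwd, LiftData.functor_bwd]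
      exact bwd_fwd f g _ _ _ _ hf hg
  · intro Y Y' g hg
    refine (naturality_of_generators (F := (whiskerRightData Y).functor)
      (G := (whiskerRightData Y').functor) (fun Z => Z ◁ bwd g hg) ?_ ?_ f).symm
    · intro X X' f hf
      rw [whiskerLeft_bwd, whiskerLeft_bwd, LiftData.functor_fwd, LiftData.functor_fwd]
      exact fwd_bwd f g _ _ _ _ hf hg
    · intro X X' f hf
      rw [whiskerLeft_bwd, whiskerLeft_bwd, LiftData.functor_bwd, LiftData.functor_bwd]
      change bwd (f ▷ Y) _ ≫ bwd (X' ◁ g) _ = bwd (X ◁ g) _ ≫ bwd (f ▷ Y') _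
      rw [bwd_comp, bwd_comp]
      · exact bwd_congr (whisker_exchange _ _)
      · exact A.comp_mem _ _ (A.whiskerRight_mem _ hf _) (A.whiskerLeft_mem _ _ hg)
      · exact A.comp_mem _ _ (A.whiskerLeft_mem _ _ hg) (A.whiskerRight_mem _ hf _)

theorem associator_naturality_left {X X' : ZigzagCat A} (f : X ⟶ X') (Y Z : ZigzagCat A) :
    (f ▷ Y) ▷ Z ≫ (α_ X' Y Z).hom = (α_ X Y Z).hom ≫ f ▷ (Y ⊗ Z) := by
  refine naturality_of_generators
    (F := (whiskerRightData Y.obj).functor ⋙ (whiskerRightData Z.obj).functor)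
    (G := (whiskerRightData (Y.obj ⊗ Z.obj)).functor)
    (fun X => (ofIso (α_ X.obj Y.obj Z.obj)).hom) ?_ ?_ f
  · intro X X' f hf
    simp only [Functor.comp_map, LiftData.functor_fwd]
    dsimp only [whiskerRightData]
    erw [LiftData.functor_fwd]
    exact fwd_naturality _ _ _ _ (by simp)
  · intro X X' f hf
    simp only [Functor.comp_map, LiftData.functor_bwd]
    dsimp only [whiskerRightData]
    erw [LiftData.functor_bwd]
    exact bwd_naturality _ _ (.associator _ _ _) (.associator _ _ _) (by simp)

theorem associator_naturality_middle (X : ZigzagCat A) {Y Y' : ZigzagCat A} (f : Y ⟶ Y')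
    (Z : ZigzagCat A) :
    (X ◁ f) ▷ Z ≫ (α_ X Y' Z).hom = (α_ X Y Z).hom ≫ X ◁ (f ▷ Z) := by
  refine naturality_of_generators
    (F := (whiskerLeftData X.obj).functor ⋙ (whiskerRightData Z.obj).functor)
    (G := (whiskerRightData Z.obj).functor ⋙ (whiskerLeftData X.obj).functor)
    (fun Y => (ofIso (α_ X.obj Y.obj Z.obj)).hom) ?_ ?_ f
  · intro Y Y' f hf
    simp only [Functor.comp_map, LiftData.functor_fwd]
    dsimp only [whiskerRightData, whiskerLeftData]
    erw [LiftData.functor_fwd, LiftData.functor_fwd]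
    exact fwd_naturality _ _ _ _ (by simp)
  · intro Y Y' f hf
    simp only [Functor.comp_map, LiftData.functor_bwd]
    dsimp only [whiskerRightData, whiskerLeftData]
    erw [LiftData.functor_bwd, LiftData.functor_bwd]
    exact bwd_naturality _ _ (.associator _ _ _) (.associator _ _ _) (by simp)

theorem associator_naturality_right (X Y : ZigzagCat A) {Z Z' : ZigzagCat A} (f : Z ⟶ Z') :
    (X ⊗ Y) ◁ f ≫ (α_ X Y Z').hom = (α_ X Y Z).hom ≫ X ◁ (Y ◁ f) := by
  refine naturality_of_generators
    (F := (whiskerLeftData (X.obj ⊗ Y.obj)).functor)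
    (G := (whiskerLeftData Y.obj).functor ⋙ (whiskerLeftData X.obj).functor)
    (fun Z => (ofIso (α_ X.obj Y.obj Z.obj)).hom) ?_ ?_ f
  · intro Z Z' f hf
    simp only [Functor.comp_map, LiftData.functor_fwd]
    dsimp only [whiskerLeftData]
    erw [LiftData.functor_fwd]
    exact fwd_naturality _ _ _ _ (by simp)
  · intro Z Z' f hf
    simp only [Functor.comp_map, LiftData.functor_bwd]
    dsimp only [whiskerLeftData]
    erw [LiftData.functor_bwd]
    exact bwd_naturality _ _ (.associator _ _ _) (.associator _ _ _) (by simp)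

theorem fwd_comp_iso {X Y Z : C} (f : X ⟶ Y) (g : Y ⟶ Z) [IsIso f] [IsIso g] :
    (fwd f (SpanCat.mem_of_isIso _) : (of X : ZigzagCat A) ⟶ of Y) ≫
      fwd g (SpanCat.mem_of_isIso _) = fwd (f ≫ g) (SpanCat.mem_of_isIso _) :=
  fwd_comp _ _ _ _ _

instance monoidal : MonoidalCategory (ZigzagCat A) where
  tensorHom_def _ _ := rfl
  id_tensorHom_id X Y := by
    change 𝟙 X ▷ Y ≫ X ◁ 𝟙 Y = _
    rw [whiskerLeft_id', id_whiskerRight', Category.comp_id]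
  tensorHom_comp_tensorHom f₁ f₂ g₁ g₂ := by
    change (f₁ ▷ _ ≫ _ ◁ f₂) ≫ g₁ ▷ _ ≫ _ ◁ g₂ = (f₁ ≫ g₁) ▷ _ ≫ _ ◁ (f₂ ≫ g₂)
    rw [whiskerLeft_comp', comp_whiskerRight']
    simp only [Category.assoc]
    rw [← reassoc_of% (exchange g₁ f₂)]
  whiskerLeft_id X Y := whiskerLeft_id' X Y
  id_whiskerRight X Y := id_whiskerRight' Y X
  associator_naturality {X₁ X₂ X₃ Y₁ Y₂ Y₃} f₁ f₂ f₃ := by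
    change ((f₁ ▷ X₂ ≫ Y₁ ◁ f₂) ▷ X₃ ≫ (Y₁ ⊗ Y₂) ◁ f₃) ≫ _ =
      _ ≫ f₁ ▷ (X₂ ⊗ X₃) ≫ Y₁ ◁ (f₂ ▷ X₃ ≫ Y₂ ◁ f₃)
    rw [comp_whiskerRight', whiskerLeft_comp']
    simp only [Category.assoc]
    rw [associator_naturality_right, reassoc_of% (associator_naturality_middle Y₁ f₂ X₃),
      reassoc_of% (associator_naturality_left f₁ X₂ X₃)]
  leftUnitor_naturality {X Y} f := by
    refine naturality_of_generators (F := (whiskerLeftData (𝟙_ C)).functor) (G := 𝟭 _)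
      (fun X => (ofIso (λ_ X.obj)).hom) ?_ ?_ f
    · intro X Y f hf
      simp only [Functor.id_map, LiftData.functor_fwd]
      exact fwd_naturality _ _ _ _ (by simp)
    · intro X Y f hf
      simp only [Functor.id_map, LiftData.functor_bwd]
      exact bwd_naturality _ _ (.leftUnitor _) (.leftUnitor _) (by simp)
  rightUnitor_naturality {X Y} f := by
    refine naturality_of_generators (F := (whiskerRightData (𝟙_ C)).functor) (G := 𝟭 _)
      (fun X => (ofIso (ρ_ X.obj)).hom) ?_ ?_ f
    · intro X Y f hf
      simp only [Functor.id_map, LiftData.functor_fwd]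
      exact fwd_naturality _ _ _ _ (by simp)
    · intro X Y f hf
      simp only [Functor.id_map, LiftData.functor_bwd]
      exact bwd_naturality _ _ (.rightUnitor _) (.rightUnitor _) (by simp)
  pentagon X Y Z T := by
    change (fwd _ _) ▷ T ≫ fwd _ _ ≫ X ◁ (fwd _ _) = fwd _ _ ≫ fwd _ _
    rw [fwd_whiskerRight, whiskerLeft_fwd]
    repeat rw [fwd_comp_iso]
    exact fwd_congr (MonoidalCategory.pentagon _ _ _ _)
  triangle X Y := by
    change fwd _ _ ≫ X ◁ (fwd _ _) = (fwd _ _) ▷ Y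
    rw [fwd_whiskerRight, whiskerLeft_fwd]
    repeat rw [fwd_comp_iso]
    exact fwd_congr (MonoidalCategory.triangle _ _)

instance symmetric : SymmetricCategory (ZigzagCat A) where
  braiding X Y := ofIso (β_ X.obj Y.obj)
  braiding_naturality_right X Y Z f := by
    refine naturality_of_generators (F := (whiskerLeftData X.obj).functor)
      (G := (whiskerRightData X.obj).functor) (fun Y => (ofIso (β_ X.obj Y.obj)).hom) ?_ ?_ f
    · intro X Y f hf
      simp only [LiftData.functor_fwd]
      exact fwd_naturality _ _ _ _ (by simp)
    · intro X Y f hf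
      simp only [LiftData.functor_bwd]
      exact bwd_naturality _ _ (.braiding _ _) (.braiding _ _) (by simp)
  braiding_naturality_left f Z := by
    refine naturality_of_generators (F := (whiskerRightData Z.obj).functor)
      (G := (whiskerLeftData Z.obj).functor) (fun Y => (ofIso (β_ Y.obj Z.obj)).hom) ?_ ?_ f
    · intro X Y f hf
      simp only [LiftData.functor_fwd]
      exact fwd_naturality _ _ _ _ (by simp)
    · intro X Y f hf
      simp only [LiftData.functor_bwd]
      exact bwd_naturality _ _ (.braiding _ _) (.braiding _ _) (by simp)
  hexagon_forward X Y Z := by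
    change fwd _ _ ≫ fwd _ _ ≫ fwd _ _ = (fwd _ _) ▷ Z ≫ fwd _ _ ≫ Y ◁ (fwd _ _)
    rw [fwd_whiskerRight, whiskerLeft_fwd]
    repeat rw [fwd_comp_iso]
    exact fwd_congr (BraidedCategory.hexagon_forward _ _ _)
  hexagon_reverse X Y Z := by
    change fwd _ _ ≫ fwd _ _ ≫ fwd _ _ = X ◁ (fwd _ _) ≫ fwd _ _ ≫ (fwd _ _) ▷ Y
    rw [fwd_whiskerRight, whiskerLeft_fwd]
    repeat rw [fwd_comp_iso]
    exact fwd_congr (BraidedCategory.hexagon_reverse _ _ _)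
  symmetry X Y := by
    change fwd _ _ ≫ fwd _ _ = 𝟙 _
    rw [fwd_comp_iso, ← fwd_id _ (A.id_mem _)]
    exact fwd_congr (SymmetricCategory.symmetry _ _)

end Monoidal
end ZigzagCat

/-! ### The categories of cospans and corelations, and the functors between them -/

/-- Isomorphism classes of cospans in `C`. -/
abbrev CospanCat (C : Type u) [Category.{v} C] : Type u :=
  CospanMod (MorphismProperty.isomorphisms C)

/-- Corelations in `C`: cospans modulo the equivalence relation generated by maps in `M`. -/
abbrev CorelCat {C : Type u} [Category.{v} C] (M : MorphismProperty C) : Type u :=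
  CospanMod M

instance isomorphisms_isMonoidal {C : Type u} [Category.{v} C] [MonoidalCategory C] :
    (MorphismProperty.isomorphisms C).IsMonoidal where
  whiskerLeft X _ _ g (_ : IsIso g) := inferInstanceAs (IsIso (X ◁ g))
  whiskerRight f (_ : IsIso f) Y := inferInstanceAs (IsIso (f ▷ Y))

section CospanToCorel

variable {C : Type u} [Category.{v} C] [HasPushouts C] (M : MorphismProperty C)
  [M.IsMultiplicative] [M.IsStableUnderCobaseChange]

/-- The functor `Γ`, sending the isomorphism class of a cospan to the corelation it represents. -/
noncomputable def cospanToCorel : CospanCat C ⥤ CorelCat M where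
  obj X := .of X.obj
  map {X Y} := Quot.map id (by
    rintro a b ⟨m, hm, h⟩
    have : IsIso m := hm
    exact ⟨m, CospanMod.mem_of_isIso m, h⟩)
  map_id _ := rfl
  map_comp {X Y Z} a b := by
    induction a using CospanMod.hom_ind with
    | h f g =>
    induction b using CospanMod.hom_ind with
    | h h k =>
    have sq := IsPushout.of_hasPushout g h
    rw [CospanMod.homMk_comp sq]
    exact (CospanMod.homMk_comp (W := M) (X := .of X.obj) (Y := .of Y.obj) (Z := .of Z.obj)
      (f := f) (k := k) sq).symm

theorem cospanToCorel_map_homMk {X Y : CospanCat C} {N : C} (f : X.obj ⟶ N) (g : Y.obj ⟶ N) :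
    (cospanToCorel M).map (CospanMod.homMk f g : X ⟶ Y) =
      (CospanMod.homMk f g : (.of X.obj : CorelCat M) ⟶ .of Y.obj) := rfl

end CospanToCorel

section SpanToCorel

variable {C : Type u} [Category.{v} C] [HasPushouts C] [HasPullbacks C] (A M : MorphismProperty C)
  [M.IsMultiplicative] [M.IsStableUnderCobaseChange] [A.IsMultiplicative]
  [A.IsStableUnderBaseChange] [CanonicalMapsIn A M]

/-- The functor `Π`, sending the class of a span in `A` to the corelation represented by the
pushout of the span. -/
noncomputable def spanToCorel : SpanCat A ⥤ CorelCat M where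
  obj X := .of X.obj
  map {X Y} := Quot.lift (fun S => CospanMod.homMk (pushout.inl S.l S.r) (pushout.inr S.l S.r)) (by
    rintro S T ⟨e⟩
    rw [← CospanMod.bwd_comp_fwd (IsPushout.of_hasPushout S.l S.r),
      ← CospanMod.bwd_comp_fwd (IsPushout.of_hasPushout T.l T.r), ← Span.Hom.hom_l e.hom,
      ← Span.Hom.hom_r e.hom, CospanMod.bwd_comp, CospanMod.fwd_comp, Category.assoc]
    exact congrArg (CospanMod.bwd T.l ≫ ·)
      (CospanMod.bwd_comp_fwd_iso_assoc (SpanCat.apexIso e) _))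
  map_id X := by
    exact (CospanMod.bwd_comp_fwd (IsPushout.of_hasPushout (𝟙 X.obj) (𝟙 X.obj))).symm.trans
      (Category.comp_id _)
  map_comp {X Y Z} a b := by
    induction a using SpanCat.hom_ind with
    | h f g hf hg =>
    induction b using SpanCat.hom_ind with
    | h h k hh hk =>
    have sq := IsPullback.of_hasPullback g h
    rw [SpanCat.homMk_comp sq]
    refine (CospanMod.bwd_comp_fwd (W := M) (IsPushout.of_hasPushout (pullback.fst g h ≫ f)
      (pullback.snd g h ≫ k))).symm.trans ?_
    refine Eq.trans ?_ (congrArg₂ (· ≫ ·)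
      (CospanMod.bwd_comp_fwd (W := M) (IsPushout.of_hasPushout f g))
      (CospanMod.bwd_comp_fwd (W := M) (IsPushout.of_hasPushout h k)))
    have key : (CospanMod.fwd g : (.of _ : CorelCat M) ⟶ .of _) ≫ CospanMod.bwd h =
        CospanMod.bwd (pullback.fst g h) ≫ CospanMod.fwd (pullback.snd g h) := by
      have po := IsPushout.of_hasPushout (pullback.fst g h) (pullback.snd g h)
      rw [CospanMod.bwd_comp_fwd po, CospanMod.fwd_comp_bwd]
      refine (CospanMod.homMk_sound (po.desc g h sq.w) ?_ (by simp) (by simp)).symm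
      exact CanonicalMapsIn.canonical_mem (A := A) _ hg hh sq po (by simp) (by simp)
    simp only [CospanMod.bwd_comp, CospanMod.fwd_comp, Category.assoc]
    rw [reassoc_of% key]

theorem spanToCorel_map_homMk {X Y : SpanCat A} {N P : C} {f : N ⟶ X.obj} {g : N ⟶ Y.obj}
    (hf : A f) (hg : A g) {i : X.obj ⟶ P} {j : Y.obj ⟶ P} (sq : IsPushout f g i j) :
    (spanToCorel A M).map (SpanCat.homMk f g hf hg : X ⟶ Y) =
      (CospanMod.homMk i j : (.of X.obj : CorelCat M) ⟶ .of Y.obj) :=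
  (CospanMod.bwd_comp_fwd (IsPushout.of_hasPushout f g)).symm.trans (CospanMod.bwd_comp_fwd sq)

end SpanToCorel

section Legs

variable {C : Type u} [Category.{v} C] [MonoidalCategory C] [SymmetricCategory C]
  (A : MorphismProperty C) [A.IsMonoidal] [A.IsStableUnderBaseChange]

/-- The interpretation of zigzags as cospans. -/
noncomputable def zigzagToCospanData [HasPushouts C] [TensorPreservesPushouts C] :
    ZigzagCat.LiftData A (CospanCat C) where
  obj X := .of X
  fwd f _ := CospanMod.fwd f
  bwd f _ := CospanMod.bwd f
  fwd_id X _ := CospanMod.fwd_id X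
  bwd_id X _ := CospanMod.bwd_id X
  fwd_comp f g _ _ _ := (CospanMod.fwd_comp f g).symm
  bwd_comp f g _ _ _ := (CospanMod.bwd_comp f g).symm
  fwd_bwd {X X' Y Y'} f g _ _ _ _ _ _ := by
    have := whisker_exchange (C := CospanCat C) (CospanMod.fwd f) (CospanMod.bwd g)
    simp only [CospanMod.fwd_whiskerRight, CospanMod.whiskerLeft_bwd] at this
    exact this.symm
  bwd_fwd {X X' Y Y'} f g _ _ _ _ _ _ := by
    have := whisker_exchange (C := CospanCat C) (CospanMod.bwd f) (CospanMod.fwd g)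
    simp only [CospanMod.bwd_whiskerRight, CospanMod.whiskerLeft_fwd] at this
    exact this.symm
  structural e _ _ _ := CospanMod.fwd_eq_bwd_inv e

/-- The functor from zigzags in `A` to cospans in `C`. -/
noncomputable def zigzagToCospan [HasPushouts C] [TensorPreservesPushouts C] :
    ZigzagCat A ⥤ CospanCat C :=
  (zigzagToCospanData A).functor

/-- The interpretation of zigzags as spans. -/
noncomputable def zigzagToSpanData [HasPullbacks C] [TensorPreservesPullbacks A] :
    ZigzagCat.LiftData A (SpanCat A) where
  obj X := .of X
  fwd f hf := SpanCat.fwd f hf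
  bwd f hf := SpanCat.bwd f hf
  fwd_id X _ := SpanCat.fwd_id X
  bwd_id X _ := SpanCat.bwd_id X
  fwd_comp f g hf hg _ := SpanCat.fwd_comp f g hf hg
  bwd_comp f g hf hg _ := SpanCat.bwd_comp f g hf hg
  fwd_bwd {X X' Y Y'} f g _ _ _ _ hf hg := by
    have := whisker_exchange (C := SpanCat A) (SpanCat.fwd f hf) (SpanCat.bwd g hg)
    simp only [SpanCat.fwd_whiskerRight, SpanCat.whiskerLeft_bwd] at this
    exact this.symm
  bwd_fwd {X X' Y Y'} f g _ _ _ _ hf hg := by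
    have := whisker_exchange (C := SpanCat A) (SpanCat.bwd f hf) (SpanCat.fwd g hg)
    simp only [SpanCat.bwd_whiskerRight, SpanCat.whiskerLeft_fwd] at this
    exact this.symm
  structural e _ _ _ := SpanCat.fwd_eq_bwd_inv e

/-- The functor from zigzags in `A` to spans in `A`. -/
noncomputable def zigzagToSpan [HasPullbacks C] [TensorPreservesPullbacks A] :
    ZigzagCat A ⥤ SpanCat A :=
  (zigzagToSpanData A).functor

end Legs

/-! ### Monoidal structures on the functors -/

section MonoidalFunctors

variable {C : Type u} [Category.{v} C] [MonoidalCategory C] [SymmetricCategory C]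

theorem strict_assoc_aux {D : Type*} [Category* D] [MonoidalCategory D] (X Y Z : D) :
    𝟙 (X ⊗ Y) ▷ Z ≫ 𝟙 ((X ⊗ Y) ⊗ Z) ≫ (α_ X Y Z).hom =
      (α_ X Y Z).hom ≫ X ◁ 𝟙 (Y ⊗ Z) ≫ 𝟙 (X ⊗ Y ⊗ Z) := by simp

theorem strict_left_aux {D : Type*} [Category* D] [MonoidalCategory D] (X : D) :
    (λ_ X).hom = 𝟙 (𝟙_ D) ▷ X ≫ 𝟙 (𝟙_ D ⊗ X) ≫ (λ_ X).hom := by simp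

theorem strict_right_aux {D : Type*} [Category* D] [MonoidalCategory D] (X : D) :
    (ρ_ X).hom = X ◁ 𝟙 (𝟙_ D) ≫ 𝟙 (X ⊗ 𝟙_ D) ≫ (ρ_ X).hom := by simp

section

variable (A : MorphismProperty C) [A.IsMonoidal] [A.IsStableUnderBaseChange] [HasPushouts C]
  [TensorPreservesPushouts C]

theorem zigzagToCospan_fwd {X Y : C} (f : X ⟶ Y) (hf : A f) :
    (zigzagToCospan A).map (ZigzagCat.fwd f hf) = CospanMod.fwd f :=
  (zigzagToCospanData A).functor_fwd f hf

theorem zigzagToCospan_bwd {X Y : C} (f : Y ⟶ X) (hf : A f) :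
    (zigzagToCospan A).map (ZigzagCat.bwd f hf) = CospanMod.bwd f :=
  (zigzagToCospanData A).functor_bwd f hf

theorem zigzagToCospan_whiskerRight {X Y : ZigzagCat A} (f : X ⟶ Y) (Z : ZigzagCat A) :
    (zigzagToCospan A).map f ▷ (zigzagToCospan A).obj Z = (zigzagToCospan A).map (f ▷ Z) := by
  have := ZigzagCat.naturality_of_generators
    (F := zigzagToCospan A ⋙ tensorRight ((zigzagToCospan A).obj Z))
    (G := tensorRight Z ⋙ zigzagToCospan A)
    (fun X => 𝟙 (.of (X.obj ⊗ Z.obj) : CospanCat C)) ?_ ?_ f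
  · exact (Category.comp_id _).symm.trans (this.trans (Category.id_comp _))
  · intro X Y f hf
    refine (Category.comp_id _).trans (Eq.trans ?_ (Category.id_comp _).symm)
    exact (congrArg (· ▷ (zigzagToCospan A).obj Z) (zigzagToCospan_fwd A f hf)).trans ((CospanMod.fwd_whiskerRight f _).trans
      ((congrArg (zigzagToCospan A).map (ZigzagCat.fwd_whiskerRight Z f hf)).trans (zigzagToCospan_fwd A _ _)).symm)
  · intro X Y f hf
    refine (Category.comp_id _).trans (Eq.trans ?_ (Category.id_comp _).symm)
    exact (congrArg (· ▷ (zigzagToCospan A).obj Z) (zigzagToCospan_bwd A f hf)).trans ((CospanMod.bwd_whiskerRight f _).trans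
      ((congrArg (zigzagToCospan A).map (ZigzagCat.bwd_whiskerRight Z f hf)).trans (zigzagToCospan_bwd A _ _)).symm)

theorem zigzagToCospan_whiskerLeft {X Y : ZigzagCat A} (f : X ⟶ Y) (Z : ZigzagCat A) :
    (zigzagToCospan A).obj Z ◁ (zigzagToCospan A).map f = (zigzagToCospan A).map (Z ◁ f) := by
  have := ZigzagCat.naturality_of_generators
    (F := zigzagToCospan A ⋙ tensorLeft ((zigzagToCospan A).obj Z))
    (G := tensorLeft Z ⋙ zigzagToCospan A)
    (fun X => 𝟙 (.of (Z.obj ⊗ X.obj) : CospanCat C)) ?_ ?_ f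
  · exact (Category.comp_id _).symm.trans (this.trans (Category.id_comp _))
  · intro X Y f hf
    refine (Category.comp_id _).trans (Eq.trans ?_ (Category.id_comp _).symm)
    exact (congrArg ((zigzagToCospan A).obj Z ◁ ·) (zigzagToCospan_fwd A f hf)).trans ((CospanMod.whiskerLeft_fwd f _).trans
      ((congrArg (zigzagToCospan A).map (ZigzagCat.whiskerLeft_fwd Z f hf)).trans (zigzagToCospan_fwd A _ _)).symm)
  · intro X Y f hf
    refine (Category.comp_id _).trans (Eq.trans ?_ (Category.id_comp _).symm)
    exact (congrArg ((zigzagToCospan A).obj Z ◁ ·) (zigzagToCospan_bwd A f hf)).trans ((CospanMod.whiskerLeft_bwd f _).trans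
      ((congrArg (zigzagToCospan A).map (ZigzagCat.whiskerLeft_bwd Z f hf)).trans (zigzagToCospan_bwd A _ _)).symm)

theorem zigzagToCospan_ofIso {X Y : C} (e : X ≅ Y) :
    (zigzagToCospan A).map (ZigzagCat.ofIso e).hom = (CospanMod.ofIso e).hom :=
  zigzagToCospan_fwd A _ _

noncomputable instance : (zigzagToCospan A).LaxMonoidal where
  ε := 𝟙 ((zigzagToCospan A).obj (𝟙_ _))
  μ X Y := 𝟙 ((zigzagToCospan A).obj (X ⊗ Y))
  μ_natural_left f Z := (Category.comp_id _).trans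
    ((zigzagToCospan_whiskerRight A f Z).trans (Category.id_comp _).symm)
  μ_natural_right Z f := (Category.comp_id _).trans
    ((zigzagToCospan_whiskerLeft A f Z).trans (Category.id_comp _).symm)
  associativity X Y Z :=
    (congrArg (fun g => 𝟙 ((zigzagToCospan A).obj X ⊗ (zigzagToCospan A).obj Y) ▷ (zigzagToCospan A).obj Z ≫
      𝟙 (((zigzagToCospan A).obj X ⊗ (zigzagToCospan A).obj Y) ⊗ (zigzagToCospan A).obj Z) ≫ g) (zigzagToCospan_ofIso A _)).trans
      (strict_assoc_aux ((zigzagToCospan A).obj X) ((zigzagToCospan A).obj Y) ((zigzagToCospan A).obj Z))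
  left_unitality X := (strict_left_aux ((zigzagToCospan A).obj X)).trans
    (congrArg (fun g => 𝟙 (𝟙_ _) ▷ (zigzagToCospan A).obj X ≫ 𝟙 (𝟙_ _ ⊗ (zigzagToCospan A).obj X) ≫ g) (zigzagToCospan_ofIso A _).symm)
  right_unitality X := (strict_right_aux ((zigzagToCospan A).obj X)).trans
    (congrArg (fun g => (zigzagToCospan A).obj X ◁ 𝟙 (𝟙_ _) ≫ 𝟙 ((zigzagToCospan A).obj X ⊗ 𝟙_ _) ≫ g) (zigzagToCospan_ofIso A _).symm)

end

section

variable (A : MorphismProperty C) [A.IsMonoidal] [A.IsStableUnderBaseChange] [HasPullbacks C]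
  [TensorPreservesPullbacks A]

theorem zigzagToSpan_fwd {X Y : C} (f : X ⟶ Y) (hf : A f) :
    (zigzagToSpan A).map (ZigzagCat.fwd f hf) = SpanCat.fwd f hf :=
  (zigzagToSpanData A).functor_fwd f hf

theorem zigzagToSpan_bwd {X Y : C} (f : Y ⟶ X) (hf : A f) :
    (zigzagToSpan A).map (ZigzagCat.bwd f hf) = SpanCat.bwd f hf :=
  (zigzagToSpanData A).functor_bwd f hf

theorem zigzagToSpan_whiskerRight {X Y : ZigzagCat A} (f : X ⟶ Y) (Z : ZigzagCat A) :
    (zigzagToSpan A).map f ▷ (zigzagToSpan A).obj Z = (zigzagToSpan A).map (f ▷ Z) := by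
  have := ZigzagCat.naturality_of_generators
    (F := zigzagToSpan A ⋙ tensorRight ((zigzagToSpan A).obj Z))
    (G := tensorRight Z ⋙ zigzagToSpan A)
    (fun X => 𝟙 (.of (X.obj ⊗ Z.obj) : SpanCat A)) ?_ ?_ f
  · exact (Category.comp_id _).symm.trans (this.trans (Category.id_comp _))
  · intro X Y f hf
    refine (Category.comp_id _).trans (Eq.trans ?_ (Category.id_comp _).symm)
    exact (congrArg (· ▷ (zigzagToSpan A).obj Z) (zigzagToSpan_fwd A f hf)).trans ((SpanCat.fwd_whiskerRight f hf _).trans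
      ((congrArg (zigzagToSpan A).map (ZigzagCat.fwd_whiskerRight Z f hf)).trans (zigzagToSpan_fwd A _ _)).symm)
  · intro X Y f hf
    refine (Category.comp_id _).trans (Eq.trans ?_ (Category.id_comp _).symm)
    exact (congrArg (· ▷ (zigzagToSpan A).obj Z) (zigzagToSpan_bwd A f hf)).trans ((SpanCat.bwd_whiskerRight f hf _).trans
      ((congrArg (zigzagToSpan A).map (ZigzagCat.bwd_whiskerRight Z f hf)).trans (zigzagToSpan_bwd A _ _)).symm)

theorem zigzagToSpan_whiskerLeft {X Y : ZigzagCat A} (f : X ⟶ Y) (Z : ZigzagCat A) :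
    (zigzagToSpan A).obj Z ◁ (zigzagToSpan A).map f = (zigzagToSpan A).map (Z ◁ f) := by
  have := ZigzagCat.naturality_of_generators
    (F := zigzagToSpan A ⋙ tensorLeft ((zigzagToSpan A).obj Z))
    (G := tensorLeft Z ⋙ zigzagToSpan A)
    (fun X => 𝟙 (.of (Z.obj ⊗ X.obj) : SpanCat A)) ?_ ?_ f
  · exact (Category.comp_id _).symm.trans (this.trans (Category.id_comp _))
  · intro X Y f hf
    refine (Category.comp_id _).trans (Eq.trans ?_ (Category.id_comp _).symm)
    exact (congrArg ((zigzagToSpan A).obj Z ◁ ·) (zigzagToSpan_fwd A f hf)).trans ((SpanCat.whiskerLeft_fwd f hf _).trans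
      ((congrArg (zigzagToSpan A).map (ZigzagCat.whiskerLeft_fwd Z f hf)).trans (zigzagToSpan_fwd A _ _)).symm)
  · intro X Y f hf
    refine (Category.comp_id _).trans (Eq.trans ?_ (Category.id_comp _).symm)
    exact (congrArg ((zigzagToSpan A).obj Z ◁ ·) (zigzagToSpan_bwd A f hf)).trans ((SpanCat.whiskerLeft_bwd f hf _).trans
      ((congrArg (zigzagToSpan A).map (ZigzagCat.whiskerLeft_bwd Z f hf)).trans (zigzagToSpan_bwd A _ _)).symm)

theorem zigzagToSpan_ofIso {X Y : C} (e : X ≅ Y) :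
    (zigzagToSpan A).map (ZigzagCat.ofIso e).hom = (SpanCat.ofIso e).hom :=
  zigzagToSpan_fwd A _ _

noncomputable instance : (zigzagToSpan A).LaxMonoidal where
  ε := 𝟙 ((zigzagToSpan A).obj (𝟙_ _))
  μ X Y := 𝟙 ((zigzagToSpan A).obj (X ⊗ Y))
  μ_natural_left f Z := (Category.comp_id _).trans
    ((zigzagToSpan_whiskerRight A f Z).trans (Category.id_comp _).symm)
  μ_natural_right Z f := (Category.comp_id _).trans
    ((zigzagToSpan_whiskerLeft A f Z).trans (Category.id_comp _).symm)
  associativity X Y Z :=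
    (congrArg (fun g => 𝟙 ((zigzagToSpan A).obj X ⊗ (zigzagToSpan A).obj Y) ▷ (zigzagToSpan A).obj Z ≫
      𝟙 (((zigzagToSpan A).obj X ⊗ (zigzagToSpan A).obj Y) ⊗ (zigzagToSpan A).obj Z) ≫ g) (zigzagToSpan_ofIso A _)).trans
      (strict_assoc_aux ((zigzagToSpan A).obj X) ((zigzagToSpan A).obj Y) ((zigzagToSpan A).obj Z))
  left_unitality X := (strict_left_aux ((zigzagToSpan A).obj X)).trans
    (congrArg (fun g => 𝟙 (𝟙_ _) ▷ (zigzagToSpan A).obj X ≫ 𝟙 (𝟙_ _ ⊗ (zigzagToSpan A).obj X) ≫ g) (zigzagToSpan_ofIso A _).symm)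
  right_unitality X := (strict_right_aux ((zigzagToSpan A).obj X)).trans
    (congrArg (fun g => (zigzagToSpan A).obj X ◁ 𝟙 (𝟙_ _) ≫ 𝟙 ((zigzagToSpan A).obj X ⊗ 𝟙_ _) ≫ g) (zigzagToSpan_ofIso A _).symm)

end

section

variable (M : MorphismProperty C) [M.IsMonoidal] [M.IsStableUnderCobaseChange] [HasPushouts C]
  [TensorPreservesPushouts C]

theorem cospanToCorel_tensor {X Y X' Y' : CospanCat C} (f : X ⟶ Y) (g : X' ⟶ Y') :
    (cospanToCorel M).map f ⊗ₘ (cospanToCorel M).map g = (cospanToCorel M).map (f ⊗ₘ g) := by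
  induction f using CospanMod.hom_ind with
  | h a b =>
  induction g using CospanMod.hom_ind with
  | h c d => rfl

theorem cospanToCorel_whiskerRight {X Y : CospanCat C} (f : X ⟶ Y) (Z : CospanCat C) :
    (cospanToCorel M).map f ▷ (cospanToCorel M).obj Z = (cospanToCorel M).map (f ▷ Z) :=
  cospanToCorel_tensor M f (𝟙 Z)

theorem cospanToCorel_whiskerLeft {X Y : CospanCat C} (f : X ⟶ Y) (Z : CospanCat C) :
    (cospanToCorel M).obj Z ◁ (cospanToCorel M).map f = (cospanToCorel M).map (Z ◁ f) :=
  cospanToCorel_tensor M (𝟙 Z) f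

theorem cospanToCorel_ofIso {X Y : C} (e : X ≅ Y) :
    (cospanToCorel M).map (CospanMod.ofIso e).hom = (CospanMod.ofIso e).hom := rfl

noncomputable instance : (cospanToCorel M).LaxMonoidal where
  ε := 𝟙 ((cospanToCorel M).obj (𝟙_ _))
  μ X Y := 𝟙 ((cospanToCorel M).obj (X ⊗ Y))
  μ_natural_left f Z := (Category.comp_id _).trans
    ((cospanToCorel_whiskerRight M f Z).trans (Category.id_comp _).symm)
  μ_natural_right Z f := (Category.comp_id _).trans
    ((cospanToCorel_whiskerLeft M f Z).trans (Category.id_comp _).symm)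
  associativity X Y Z :=
    (congrArg (fun g => 𝟙 ((cospanToCorel M).obj X ⊗ (cospanToCorel M).obj Y) ▷ (cospanToCorel M).obj Z ≫
      𝟙 (((cospanToCorel M).obj X ⊗ (cospanToCorel M).obj Y) ⊗ (cospanToCorel M).obj Z) ≫ g) (cospanToCorel_ofIso M _)).trans
      (strict_assoc_aux ((cospanToCorel M).obj X) ((cospanToCorel M).obj Y) ((cospanToCorel M).obj Z))
  left_unitality X := (strict_left_aux ((cospanToCorel M).obj X)).trans
    (congrArg (fun g => 𝟙 (𝟙_ _) ▷ (cospanToCorel M).obj X ≫ 𝟙 (𝟙_ _ ⊗ (cospanToCorel M).obj X) ≫ g) (cospanToCorel_ofIso M _).symm)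
  right_unitality X := (strict_right_aux ((cospanToCorel M).obj X)).trans
    (congrArg (fun g => (cospanToCorel M).obj X ◁ 𝟙 (𝟙_ _) ≫ 𝟙 ((cospanToCorel M).obj X ⊗ 𝟙_ _) ≫ g) (cospanToCorel_ofIso M _).symm)

end

section

variable (A M : MorphismProperty C) [M.IsMonoidal] [M.IsStableUnderCobaseChange] [A.IsMonoidal]
  [A.IsStableUnderBaseChange] [CanonicalMapsIn A M] [HasPushouts C] [HasPullbacks C]
  [TensorPreservesPushouts C] [TensorPreservesPullbacks A]

theorem spanToCorel_tensor {X Y X' Y' : SpanCat A} (f : X ⟶ Y) (g : X' ⟶ Y') :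
    (spanToCorel A M).map f ⊗ₘ (spanToCorel A M).map g = (spanToCorel A M).map (f ⊗ₘ g) := by
  induction f using SpanCat.hom_ind with
  | h a b ha hb =>
  induction g using SpanCat.hom_ind with
  | h c d hc hd =>
  exact (spanToCorel_map_homMk A M _ _ (TensorPreservesPushouts.tensor_isPushout
    (IsPushout.of_hasPushout a b) (IsPushout.of_hasPushout c d))).symm

theorem spanToCorel_whiskerRight {X Y : SpanCat A} (f : X ⟶ Y) (Z : SpanCat A) :
    (spanToCorel A M).map f ▷ (spanToCorel A M).obj Z = (spanToCorel A M).map (f ▷ Z) :=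
  (congrArg ((spanToCorel A M).map f ⊗ₘ ·) ((spanToCorel A M).map_id Z)).symm.trans
    (spanToCorel_tensor A M f (𝟙 Z))

theorem spanToCorel_whiskerLeft {X Y : SpanCat A} (f : X ⟶ Y) (Z : SpanCat A) :
    (spanToCorel A M).obj Z ◁ (spanToCorel A M).map f = (spanToCorel A M).map (Z ◁ f) :=
  (congrArg (· ⊗ₘ (spanToCorel A M).map f) ((spanToCorel A M).map_id Z)).symm.trans
    (spanToCorel_tensor A M (𝟙 Z) f)

theorem spanToCorel_fwd {X Y : C} (f : X ⟶ Y) (hf : A f) :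
    (spanToCorel A M).map (SpanCat.fwd f hf) = CospanMod.fwd f :=
  spanToCorel_map_homMk A M _ _ (IsPushout.of_id_fst (f := f))

theorem spanToCorel_ofIso {X Y : C} (e : X ≅ Y) :
    (spanToCorel A M).map (SpanCat.ofIso e).hom = (CospanMod.ofIso e).hom :=
  spanToCorel_fwd A M _ _

noncomputable instance : (spanToCorel A M).LaxMonoidal where
  ε := 𝟙 ((spanToCorel A M).obj (𝟙_ _))
  μ X Y := 𝟙 ((spanToCorel A M).obj (X ⊗ Y))
  μ_natural_left f Z := (Category.comp_id _).trans
    ((spanToCorel_whiskerRight A M f Z).trans (Category.id_comp _).symm)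
  μ_natural_right Z f := (Category.comp_id _).trans
    ((spanToCorel_whiskerLeft A M f Z).trans (Category.id_comp _).symm)
  associativity X Y Z :=
    (congrArg (fun g => 𝟙 ((spanToCorel A M).obj X ⊗ (spanToCorel A M).obj Y) ▷ (spanToCorel A M).obj Z ≫
      𝟙 (((spanToCorel A M).obj X ⊗ (spanToCorel A M).obj Y) ⊗ (spanToCorel A M).obj Z) ≫ g) (spanToCorel_ofIso A M _)).trans
      (strict_assoc_aux ((spanToCorel A M).obj X) ((spanToCorel A M).obj Y) ((spanToCorel A M).obj Z))
  left_unitality X := (strict_left_aux ((spanToCorel A M).obj X)).trans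
    (congrArg (fun g => 𝟙 (𝟙_ _) ▷ (spanToCorel A M).obj X ≫ 𝟙 (𝟙_ _ ⊗ (spanToCorel A M).obj X) ≫ g) (spanToCorel_ofIso A M _).symm)
  right_unitality X := (strict_right_aux ((spanToCorel A M).obj X)).trans
    (congrArg (fun g => (spanToCorel A M).obj X ◁ 𝟙 (𝟙_ _) ≫ 𝟙 ((spanToCorel A M).obj X ⊗ 𝟙_ _) ≫ g) (spanToCorel_ofIso A M _).symm)

end
end MonoidalFunctors

/-! ### Categories of symmetric monoidal categories -/

/-- The three kinds of monoidal functors. -/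
inductive Strictness
  | lax
  | strong
  | strict

section Predicates

variable {C : Type*} [Category* C] [MonoidalCategory C] {D : Type*} [Category* D]
  [MonoidalCategory D]

open Functor.LaxMonoidal

/-- A lax monoidal functor is strong if its structure morphisms are isomorphisms, and strict if
they are identities (as functors commuting strictly with the tensor product and the unit, the
structure morphisms are the identities of equal objects). -/
def Strictness.Holds (F : C ⥤ D) [F.LaxMonoidal] : Strictness → Prop
  | lax => True
  | strong => IsIso (ε F) ∧ ∀ X Y : C, IsIso (μ F X Y)
  | strict => (∃ h : 𝟙_ D = F.obj (𝟙_ C), ε F = eqToHom h) ∧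
      ∀ X Y : C, ∃ h : F.obj X ⊗ F.obj Y = F.obj (X ⊗ Y), μ F X Y = eqToHom h

/-- A lax monoidal functor between symmetric monoidal categories is symmetric if it is compatible
with the symmetries. -/
def IsSymmetricFunctor [SymmetricCategory C] [SymmetricCategory D] (F : C ⥤ D) [F.LaxMonoidal] :
    Prop :=
  ∀ X Y : C, μ F X Y ≫ F.map (β_ X Y).hom = (β_ (F.obj X) (F.obj Y)).hom ≫ μ F Y X

theorem Strictness.Holds.of_strict {F : C ⥤ D} [F.LaxMonoidal] (h : strict.Holds F)
    (k : Strictness) : k.Holds F := by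
  obtain ⟨⟨h, hε⟩, hμ⟩ := h
  cases k with
  | lax => trivial
  | strong =>
    refine ⟨hε ▸ inferInstance, fun X Y => ?_⟩
    obtain ⟨h, hμ⟩ := hμ X Y
    exact hμ ▸ inferInstance
  | strict => exact ⟨⟨h, hε⟩, hμ⟩

theorem Strictness.holds_id (k : Strictness) : k.Holds (𝟭 C) :=
  Holds.of_strict ⟨⟨rfl, rfl⟩, fun _ _ => ⟨rfl, rfl⟩⟩ k

theorem isSymmetricFunctor_id [SymmetricCategory C] : IsSymmetricFunctor (𝟭 C) :=
  fun _ _ => (Category.id_comp _).trans (Category.comp_id _).symm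

variable {B : Type*} [Category* B] [MonoidalCategory B]

theorem Strictness.holds_comp (k : Strictness) (F : C ⥤ D) [F.LaxMonoidal] (G : D ⥤ B)
    [G.LaxMonoidal] (hF : k.Holds F) (hG : k.Holds G) : k.Holds (F ⋙ G) := by
  cases k with
  | lax => trivial
  | strong =>
    obtain ⟨_, h₁⟩ := hF
    obtain ⟨_, h₂⟩ := hG
    exact ⟨by rw [comp_ε]; infer_instance, fun X Y => by rw [comp_μ]; infer_instance⟩
  | strict =>
    obtain ⟨⟨h, hε⟩, h₁⟩ := hF
    obtain ⟨⟨h', hε'⟩, h₂⟩ := hG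
    refine ⟨⟨h'.trans (congrArg G.obj h), ?_⟩, fun X Y => ?_⟩
    · rw [comp_ε, hε, hε', eqToHom_map, eqToHom_trans]
    · obtain ⟨e, he⟩ := h₁ X Y
      obtain ⟨e', he'⟩ := h₂ (F.obj X) (F.obj Y)
      refine ⟨e'.trans (congrArg G.obj e), ?_⟩
      rw [comp_μ, he, he', eqToHom_map, eqToHom_trans]

theorem isSymmetricFunctor_comp [SymmetricCategory C] [SymmetricCategory D] [SymmetricCategory B]
    (F : C ⥤ D) [F.LaxMonoidal] (G : D ⥤ B) [G.LaxMonoidal] (hF : IsSymmetricFunctor F)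
    (hG : IsSymmetricFunctor G) : IsSymmetricFunctor (F ⋙ G) := by
  intro X Y
  rw [comp_μ, comp_μ, Category.assoc, Functor.comp_map, ← G.map_comp, hF, G.map_comp,
    ← Category.assoc, hG]
  exact Category.assoc _ _ _

end Predicates

set_option linter.checkUnivs false

/-- A symmetric monoidal category. -/
structure SymMonCat where of ::
  carrier : Type u
  [category : Category.{v} carrier]
  [monoidal : MonoidalCategory carrier]
  [symmetric : SymmetricCategory carrier]

attribute [instance] SymMonCat.category SymMonCat.monoidal SymMonCat.symmetric

open Functor.LaxMonoidal in
/-- Symmetric monoidal categories and lax monoidal functors. -/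
instance : Category SymMonCat.{v, u} where
  Hom X Y := LaxMonoidalFunctor X.carrier Y.carrier
  id X := .of (𝟭 X.carrier)
  comp F G := .of (F.toFunctor ⋙ G.toFunctor)
  id_comp {X Y} F := by
    have h : Functor.LaxMonoidal.comp (𝟭 X.carrier) F.toFunctor = F.laxMonoidal :=
      Functor.LaxMonoidal.ext
        ((congrArg (ε F.toFunctor ≫ ·) (F.map_id _)).trans (Category.comp_id _))
        (funext fun A => funext fun B =>
          (congrArg (μ F.toFunctor A B ≫ ·) (F.map_id _)).trans (Category.comp_id _))
    exact congrArg (fun l => (⟨F.toFunctor, l⟩ :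
      LaxMonoidalFunctor X.carrier Y.carrier)) h
  comp_id {X Y} F := by
    have h : Functor.LaxMonoidal.comp F.toFunctor (𝟭 Y.carrier) = F.laxMonoidal :=
      Functor.LaxMonoidal.ext (Category.id_comp _)
        (funext fun A => funext fun B => Category.id_comp _)
    exact congrArg (fun l => (⟨F.toFunctor, l⟩ :
      LaxMonoidalFunctor X.carrier Y.carrier)) h
  assoc {X Y Z T} F G H := by
    have h : Functor.LaxMonoidal.comp (F.toFunctor ⋙ G.toFunctor) H.toFunctor =
        Functor.LaxMonoidal.comp F.toFunctor (G.toFunctor ⋙ H.toFunctor) :=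
      Functor.LaxMonoidal.ext
        ((congrArg (ε H.toFunctor ≫ ·) (H.map_comp _ _)).trans (Category.assoc _ _ _).symm)
        (funext fun A => funext fun B =>
          (congrArg (μ H.toFunctor _ _ ≫ ·) (H.map_comp _ _)).trans (Category.assoc _ _ _).symm)
    exact congrArg (fun l => (⟨F.toFunctor ⋙ G.toFunctor ⋙ H.toFunctor, l⟩ :
      LaxMonoidalFunctor X.carrier T.carrier)) h

/-- The lax, strong or strict monoidal functors. -/
def monoidalFunctors (k : Strictness) : MorphismProperty SymMonCat.{v, u} :=
  fun _ _ (F : LaxMonoidalFunctor _ _) => k.Holds F.toFunctor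

/-- The lax, strong or strict symmetric monoidal functors. -/
def symmetricMonoidalFunctors (k : Strictness) : MorphismProperty SymMonCat.{v, u} :=
  fun _ _ (F : LaxMonoidalFunctor _ _) => k.Holds F.toFunctor ∧ IsSymmetricFunctor F.toFunctor

instance (k : Strictness) : (monoidalFunctors.{v, u} k).IsMultiplicative where
  id_mem _ := k.holds_id
  comp_mem F G hF hG :=
    k.holds_comp (LaxMonoidalFunctor.toFunctor F) (LaxMonoidalFunctor.toFunctor G) hF hG

instance (k : Strictness) : (symmetricMonoidalFunctors.{v, u} k).IsMultiplicative where
  id_mem _ := ⟨k.holds_id, isSymmetricFunctor_id⟩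
  comp_mem F G hF hG :=
    ⟨k.holds_comp (LaxMonoidalFunctor.toFunctor F) (LaxMonoidalFunctor.toFunctor G) hF.1 hG.1,
      isSymmetricFunctor_comp (LaxMonoidalFunctor.toFunctor F) (LaxMonoidalFunctor.toFunctor G)
        hF.2 hG.2⟩

/-- Symmetric monoidal categories and lax, strong or strict monoidal functors. -/
abbrev SymMonCatWith (k : Strictness) : Type _ := WideSubcategory (monoidalFunctors.{v, u} k)

/-- Symmetric monoidal categories and lax, strong or strict symmetric monoidal functors. -/
abbrev SymMonCatSymmetricWith (k : Strictness) : Type _ :=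
  WideSubcategory (symmetricMonoidalFunctors.{v, u} k)

section Bundled

variable {C D : Type u} [Category.{v} C] [MonoidalCategory C] [SymmetricCategory C]
  [Category.{v} D] [MonoidalCategory D] [SymmetricCategory D]

/-- A strict symmetric monoidal functor as a morphism of symmetric monoidal categories and
monoidal functors. -/
def monoidalHom (k : Strictness) (F : C ⥤ D) [F.LaxMonoidal] (h : Strictness.strict.Holds F) :
    (⟨.of C⟩ : SymMonCatWith.{v, u} k) ⟶ ⟨.of D⟩ :=
  ⟨LaxMonoidalFunctor.of F, h.of_strict k⟩

/-- A strict symmetric monoidal functor as a morphism of symmetric monoidal categories and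
symmetric monoidal functors. -/
def symmetricMonoidalHom (k : Strictness) (F : C ⥤ D) [F.LaxMonoidal]
    (h : Strictness.strict.Holds F) (hs : IsSymmetricFunctor F) :
    (⟨.of C⟩ : SymMonCatSymmetricWith.{v, u} k) ⟶ ⟨.of D⟩ :=
  ⟨LaxMonoidalFunctor.of F, h.of_strict k, hs⟩

end Bundled

section Strict

variable {C : Type u} [Category.{v} C] [MonoidalCategory C] [SymmetricCategory C]
  (A M : MorphismProperty C) [A.IsMonoidal] [A.IsStableUnderBaseChange] [M.IsMonoidal]
  [M.IsStableUnderCobaseChange] [CanonicalMapsIn A M] [HasPushouts C] [HasPullbacks C]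
  [TensorPreservesPushouts C] [TensorPreservesPullbacks A]

theorem zigzagToCospan_strict : Strictness.strict.Holds (zigzagToCospan A) :=
  ⟨⟨rfl, rfl⟩, fun _ _ => ⟨rfl, rfl⟩⟩

theorem zigzagToCospan_symmetric : IsSymmetricFunctor (zigzagToCospan A) := fun _ _ =>
  (Category.id_comp _).trans ((zigzagToCospan_ofIso A _).trans (Category.comp_id _).symm)

theorem zigzagToSpan_strict : Strictness.strict.Holds (zigzagToSpan A) :=
  ⟨⟨rfl, rfl⟩, fun _ _ => ⟨rfl, rfl⟩⟩

theorem zigzagToSpan_symmetric : IsSymmetricFunctor (zigzagToSpan A) := fun _ _ =>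
  (Category.id_comp _).trans ((zigzagToSpan_ofIso A _).trans (Category.comp_id _).symm)

theorem cospanToCorel_strict : Strictness.strict.Holds (cospanToCorel M) :=
  ⟨⟨rfl, rfl⟩, fun _ _ => ⟨rfl, rfl⟩⟩

theorem cospanToCorel_symmetric : IsSymmetricFunctor (cospanToCorel M) := fun _ _ =>
  (Category.id_comp _).trans ((cospanToCorel_ofIso M _).trans (Category.comp_id _).symm)

theorem spanToCorel_strict : Strictness.strict.Holds (spanToCorel A M) :=
  ⟨⟨rfl, rfl⟩, fun _ _ => ⟨rfl, rfl⟩⟩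

theorem spanToCorel_symmetric : IsSymmetricFunctor (spanToCorel A M) := fun _ _ =>
  (Category.id_comp _).trans ((spanToCorel_ofIso A M _).trans (Category.comp_id _).symm)

end Strict

end Corelations

namespace Corelations

/-! Write Φ for the functor from zigzags to spans and Ψ for the one from zigzags to cospans. The
universal property comes down to one question: when does a functor on cospans factor through the
quotient Γ?

Both Φ and Γ are bijective on objects and full: a span is its left leg backwards followed by its
right leg forwards, and a corelation is by definition a class of cospans. They are also strict
monoidal, so each is an epimorphism with respect to lax monoidal functors. Fullness determines what
a functor out of the target does on morphisms, and its structure morphisms are recovered by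
cancelling the images of invertible ones (`laxMonoidalFunctor_eq_of_comp_eq`). Since Φ and Γ are
opposite sides of the square, `isPushout_of_epi` applies: given a cocone consisting of F on spans
and G on cospans, it is enough to factor G through Γ. Compatibility with F follows by cancelling Φ,
and uniqueness by cancelling Γ.

The quotient Γ identifies the cospan f, g with f;m, g;m for m in M. In cospans the second is f, then
m forwards, then m backwards, then g backwards. So G factors through Γ as soon as it sends m
forwards followed by m backwards to an identity (`corelLift`). Because M is contained in A, this
composite is the image under Ψ of a zigzag. Composition of spans is by pullback, and the pullback of
a monomorphism along itself is trivial, so Φ sends the same zigzag to an identity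
(`SpanCat.fwd_comp_bwd_of_mono`). Since F after Φ equals G after Ψ, the functor G sends the
composite to an identity as well (`map_fwd_comp_bwd_eq_id`).

The functor so obtained on corelations has the same objects and structure morphisms as G. Hence it
is strong, strict or symmetric whenever G is (`corelLift_holds`, `corelLift_symmetric`), and a
single argument, `isPushout_wideSubcategory`, serves all six categories. The square itself commutes
because both composites agree on single forward and backward morphisms (`zigzag_square`). The
condition on the canonical maps from pushouts of pullbacks enters through the functoriality of Π,
which is part of its definition. -/

/-- A commutative square whose left and bottom sides are epimorphisms is a pushout as soon as the
second leg of every cocone factors through the bottom side. -/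
theorem isPushout_of_epi {D : Type*} [Category* D] {Z S T P : D} {f : Z ⟶ S} {g : Z ⟶ T}
    {i : S ⟶ P} {j : T ⟶ P} [Epi f] [Epi j] (w : f ≫ i = g ≫ j)
    (h : ∀ {Q : D} (a : S ⟶ Q) (b : T ⟶ Q), f ≫ a = g ≫ b → ∃ t : P ⟶ Q, j ≫ t = b) :
    IsPushout f g i j := by
  refine ⟨⟨w⟩, ⟨PushoutCocone.IsColimit.mk w
    (fun s => (h s.inl s.inr s.condition).choose) (fun s => ?_)
    (fun s => (h s.inl s.inr s.condition).choose_spec) (fun s m _ hm => ?_)⟩⟩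
  -- Only the second leg of the cocone is assumed to factor. After precomposition with `f`, the
  -- first leg is expressed through the second by the cocone condition.
  · rw [← cancel_epi f, reassoc_of% w, (h s.inl s.inr s.condition).choose_spec, s.condition]
  · rw [← cancel_epi j, hm, (h s.inl s.inr s.condition).choose_spec]

/-! ### Full functors as epimorphisms among lax monoidal functors -/

section Epimorphisms

open Functor.LaxMonoidal

variable {C : Type*} [Category* C] {D : Type*} [Category* D] {B : Type*} [Category* B]

/-- Precomposition with a full functor that is surjective on objects is injective. -/
theorem functor_eq_of_comp_eq (F : C ⥤ D) [F.Full] (hF : Function.Surjective F.obj)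
    {G H : D ⥤ B} (h : F ⋙ G = F ⋙ H) : G = H := by
  refine CategoryTheory.Functor.ext (fun Y => ?_) (fun Y Y' f => ?_)
  · obtain ⟨X, rfl⟩ := hF Y
    exact Functor.congr_obj h X
  · obtain ⟨X, rfl⟩ := hF Y
    obtain ⟨X', rfl⟩ := hF Y'
    obtain ⟨f, rfl⟩ := F.map_surjective f
    exact Functor.congr_hom h f

variable [MonoidalCategory C] [MonoidalCategory D] [MonoidalCategory B]

/-- Precomposition with a strong monoidal functor that is surjective on objects is injective on
lax monoidal structures. -/
theorem laxMonoidal_eq_of_comp_eq (F : C ⥤ D) [F.LaxMonoidal] (hF : Function.Surjective F.obj)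
    (hs : Strictness.strong.Holds F) {G : D ⥤ B} {l l' : G.LaxMonoidal}
    (h : @Functor.LaxMonoidal.comp _ _ _ _ _ _ _ _ _ F G _ l =
      @Functor.LaxMonoidal.comp _ _ _ _ _ _ _ _ _ F G _ l') : l = l' := by
  obtain ⟨_, hμ⟩ := hs
  refine Functor.LaxMonoidal.ext ?_ (funext fun Y => funext fun Y' => ?_)
  -- The unit of a composite is the unit of `G` followed by the image of the unit of `F`. The latter
  -- is invertible because `F` is strong, so it can be cancelled; the same happens below for `μ`, at
  -- pairs of objects in the image of `F`.
  · have : @ε _ _ _ _ _ _ G l ≫ G.map (ε F) = @ε _ _ _ _ _ _ G l' ≫ G.map (ε F) :=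
      congrArg (@ε _ _ _ _ _ _ (F ⋙ G)) h
    exact (cancel_mono _).1 this
  · obtain ⟨X, rfl⟩ := hF Y
    obtain ⟨X', rfl⟩ := hF Y'
    have := hμ X X'
    have : @μ _ _ _ _ _ _ G l (F.obj X) (F.obj X') ≫ G.map (μ F X X') =
        @μ _ _ _ _ _ _ G l' (F.obj X) (F.obj X') ≫ G.map (μ F X X') :=
      congrFun (congrFun (congrArg (@μ _ _ _ _ _ _ (F ⋙ G)) h) X) X'
    exact (cancel_mono _).1 this

/-- The sources and targets of `ε` and `μ` depend on the functor, so the structure morphisms of two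
merely equal functors can be compared only heterogeneously. In the applications the objects agree
definitionally and `HEq` comes from a plain equality. -/
theorem laxMonoidalFunctor_of_eq {F G : C ⥤ D} [F.LaxMonoidal] [G.LaxMonoidal] (h : F = G)
    (hε : HEq (ε F) (ε G)) (hμ : HEq (μ F) (μ G)) :
    LaxMonoidalFunctor.of F = LaxMonoidalFunctor.of G := by
  subst h
  exact congrArg (fun l => (⟨F, l⟩ : LaxMonoidalFunctor C D))
    (Functor.LaxMonoidal.ext (eq_of_heq hε) (eq_of_heq hμ))

/-- A strong monoidal functor that is full and surjective on objects is an epimorphism among lax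
monoidal functors. -/
theorem laxMonoidalFunctor_eq_of_comp_eq (F : C ⥤ D) [F.LaxMonoidal] [F.Full]
    (hF : Function.Surjective F.obj) (hs : Strictness.strong.Holds F)
    {G H : LaxMonoidalFunctor D B}
    (h : LaxMonoidalFunctor.of (F ⋙ G.toFunctor) = .of (F ⋙ H.toFunctor)) : G = H := by
  obtain ⟨G, l⟩ := G
  obtain ⟨H, l'⟩ := H
  -- The underlying functors have to be identified first; only then are the two lax structures, and
  -- the heterogeneous equality between their composites with `F`, of the same type.
  obtain rfl : G = H :=
    functor_eq_of_comp_eq F hF (congrArg LaxMonoidalFunctor.toFunctor h)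
  obtain rfl : l = l' := laxMonoidal_eq_of_comp_eq F hF hs
    (eq_of_heq (LaxMonoidalFunctor.mk.inj h).2)
  rfl

end Epimorphisms

/-! ### Epimorphisms in the categories of symmetric monoidal categories -/

section Bundled

variable {C D : Type u} [Category.{v} C] [MonoidalCategory C] [SymmetricCategory C]
  [Category.{v} D] [MonoidalCategory D] [SymmetricCategory D]

/-- Here the test functors are arbitrary lax monoidal functors, the largest of the six classes,
although `F` itself is strict. -/
theorem epi_of_full (F : C ⥤ D) [F.LaxMonoidal] [F.Full]
    (hF : Function.Surjective F.obj) (hs : Strictness.strict.Holds F) :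
    Epi (C := SymMonCat.{v, u}) (X := .of C) (Y := .of D) (LaxMonoidalFunctor.of F) :=
  ⟨fun _ _ h => laxMonoidalFunctor_eq_of_comp_eq F hF (hs.of_strict .strong) h⟩

/-- The inclusion of a wide subcategory is faithful and so reflects epimorphisms. This carries the
cancellation property from lax monoidal functors to all the smaller classes at once. -/
theorem epi_wideSubcategory {P : MorphismProperty SymMonCat.{v, u}} [P.IsMultiplicative]
    {X Y : WideSubcategory P} (f : X ⟶ Y) (hf : Epi f.hom) : Epi f :=
  (wideSubcategoryInclusion P).epi_of_epi_map hf

end Bundled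

/-! ### Fullness of Γ and of the functor from zigzags to spans -/

section Fullness

variable {C : Type u} [Category.{v} C]

instance [HasPushouts C] (M : MorphismProperty C) [M.IsMultiplicative]
    [M.IsStableUnderCobaseChange] : (cospanToCorel M).Full where
  map_surjective {X Y} a := by
    induction a using CospanMod.hom_ind with
    | h f g => exact ⟨CospanMod.homMk f g, rfl⟩

theorem cospanToCorel_obj_surjective [HasPushouts C] (M : MorphismProperty C) [M.IsMultiplicative]
    [M.IsStableUnderCobaseChange] : Function.Surjective (cospanToCorel M).obj :=
  fun X => ⟨.of X.obj, rfl⟩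

/-- The normal form of a span: the pullback involved is that of two identities of the apex. It shows
that every span is the image of a zigzag of length two. -/
theorem SpanCat.bwd_comp_fwd {A : MorphismProperty C} [A.IsMultiplicative]
    [A.IsStableUnderBaseChange] [HasPullbacks C] {X Y N : C} (f : N ⟶ X) (g : N ⟶ Y) (hf : A f)
    (hg : A g) :
    (SpanCat.bwd f hf : (SpanCat.of X : SpanCat A) ⟶ .of N) ≫ SpanCat.fwd g hg =
      SpanCat.homMk f g hf hg := by
  simp only [SpanCat.fwd, SpanCat.bwd]
  rw [SpanCat.homMk_comp (IsPullback.of_id_fst (f := 𝟙 N))]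
  exact SpanCat.homMk_congr (by simp) (by simp)

/-- A monomorphism followed by itself pointing backwards is the identity span. -/
theorem SpanCat.fwd_comp_bwd_of_mono {A : MorphismProperty C} [A.IsMultiplicative]
    [A.IsStableUnderBaseChange] [HasPullbacks C] {X Y : C} (m : X ⟶ Y) [Mono m] (hm : A m) :
    (SpanCat.fwd m hm : (SpanCat.of X : SpanCat A) ⟶ .of Y) ≫ SpanCat.bwd m hm =
      𝟙 (SpanCat.of X) := by
  simp only [SpanCat.fwd, SpanCat.bwd]
  -- The composite span is formed with the kernel pair of `m`, which for a monomorphism consists of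
  -- two identities. This is the only place where `Mono m` is needed.
  rw [SpanCat.homMk_comp (IsKernelPair.id_of_mono m : IsPullback _ _ m m)]
  exact SpanCat.homMk_congr (by simp) (by simp)

variable [MonoidalCategory C] [SymmetricCategory C] (A : MorphismProperty C) [A.IsMonoidal]
  [A.IsStableUnderBaseChange] [HasPullbacks C] [TensorPreservesPullbacks A]

instance : (zigzagToSpan A).Full where
  map_surjective {X Y} a := by
    induction a using SpanCat.hom_ind with
    | h f g hf hg =>
      -- The preimage of a span is its left leg backwards followed by its right leg forwards; both
      -- legs lie in `A`, so this is a zigzag in `A`.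
      refine ⟨ZigzagCat.bwd f hf ≫ ZigzagCat.fwd g hg, ?_⟩
      rw [Functor.map_comp]
      exact (congrArg₂ (· ≫ ·) (zigzagToSpan_bwd A f hf) (zigzagToSpan_fwd A g hg)).trans
        (SpanCat.bwd_comp_fwd f g hf hg)

theorem zigzagToSpan_obj_surjective : Function.Surjective (zigzagToSpan A).obj :=
  fun X => ⟨.of X.obj, rfl⟩

end Fullness

/-! ### Descent of functors from cospans to corelations -/

section Descent

variable {C : Type u} [Category.{v} C] [HasPushouts C] (M : MorphismProperty C)
  [M.IsMultiplicative] [M.IsStableUnderCobaseChange] {B : Type*} [Category* B]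

/-- A functor on cospans that inverts each `m ∈ M` on one side descends to corelations. -/
noncomputable def corelLift (G : CospanCat C ⥤ B)
    (hG : ∀ {X Y : C} (m : X ⟶ Y), M m →
      G.map ((CospanMod.fwd m : (.of X : CospanCat C) ⟶ .of Y) ≫ CospanMod.bwd m) = 𝟙 _) :
    CorelCat M ⥤ B where
  obj X := G.obj (.of X.obj)
  map {X Y} := Quot.lift
    (fun a => G.map (CospanMod.homMk a.inl a.inr : (.of X.obj : CospanCat C) ⟶ .of Y.obj)) (by
      rintro ⟨N, f, g⟩ ⟨N', f', g'⟩ ⟨m, hm, hf, hg⟩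
      dsimp only at m hm hf hg ⊢
      subst hf hg
      -- Written as a forward followed by a backward morphism, the enlarged cospan differs from the
      -- original one exactly by `m` forwards and `m` backwards inserted in the middle, and `hG`
      -- removes this factor.
      rw [← CospanMod.fwd_comp_bwd, ← CospanMod.fwd_comp_bwd, CospanMod.fwd_comp,
        CospanMod.bwd_comp, Category.assoc, ← Category.assoc (CospanMod.fwd m), Functor.map_comp,
        Functor.map_comp, Functor.map_comp _ (CospanMod.fwd m ≫ CospanMod.bwd m), hG m hm,
        Category.id_comp])
  map_id X := G.map_id (.of X.obj)
  map_comp {X Y Z} a b := by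
    induction a using CospanMod.hom_ind with
    | h f g =>
    induction b using CospanMod.hom_ind with
    | h h k =>
    have sq := IsPushout.of_hasPushout g h
    rw [CospanMod.homMk_comp sq]
    -- The same pushout square `sq` composes representatives before and after passing to
    -- corelations, so preservation of composites is inherited from `G`.
    exact (congrArg G.map (CospanMod.homMk_comp (W := .isomorphisms C) (X := .of X.obj) (Y := .of Y.obj) (Z := .of Z.obj)
      (f := f) (k := k) sq).symm).trans (G.map_comp _ _)

variable (G : CospanCat C ⥤ B)
  (hG : ∀ {X Y : C} (m : X ⟶ Y), M m →
    G.map ((CospanMod.fwd m : (.of X : CospanCat C) ⟶ .of Y) ≫ CospanMod.bwd m) = 𝟙 _)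

theorem cospanToCorel_comp_corelLift : cospanToCorel M ⋙ corelLift M G hG = G := by
  refine CategoryTheory.Functor.hext (fun _ => rfl) (fun X Y a => heq_of_eq ?_)
  induction a using CospanMod.hom_ind with
  | h f g => rfl

end Descent

/-! ### Descent of the monoidal structure -/

section MonoidalDescent

open Functor.LaxMonoidal

variable {C : Type u} [Category.{v} C] [MonoidalCategory C] [HasPushouts C]
  [TensorPreservesPushouts C] (M : MorphismProperty C) [M.IsMonoidal]
  [M.IsStableUnderCobaseChange] {B : Type*} [Category* B] [MonoidalCategory B]
  (G : CospanCat C ⥤ B) [G.LaxMonoidal]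
  (hG : ∀ {X Y : C} (m : X ⟶ Y), M m →
    G.map ((CospanMod.fwd m : (.of X : CospanCat C) ⟶ .of Y) ≫ CospanMod.bwd m) = 𝟙 _)

/-- Tensor products and coherence isomorphisms of corelations are represented by those of cospans,
so the structure morphisms of `G` can be used unchanged. Naturality is checked on representatives,
and each coherence axiom is definitionally the one for `G`. -/
noncomputable instance corelLift_laxMonoidal : (corelLift M G hG).LaxMonoidal where
  ε := ε G
  μ X Y := μ G (.of X.obj) (.of Y.obj)
  μ_natural_left {X Y} a Z := by
    induction a using CospanMod.hom_ind with
    | h f g =>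
      exact μ_natural_left G (CospanMod.homMk f g : (.of X.obj : CospanCat C) ⟶ .of Y.obj)
        (.of Z.obj)
  μ_natural_right {X Y} Z a := by
    induction a using CospanMod.hom_ind with
    | h f g =>
      exact μ_natural_right G (.of Z.obj)
        (CospanMod.homMk f g : (.of X.obj : CospanCat C) ⟶ .of Y.obj)
  associativity X Y Z := associativity G (.of X.obj) (.of Y.obj) (.of Z.obj)
  left_unitality X := left_unitality G (.of X.obj)
  right_unitality X := right_unitality G (.of X.obj)

/-- The structure morphisms are literally those of `G`, between the same objects, so invertibility
and being an identity are inherited. This closes the strong and strict classes under descent. -/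
theorem corelLift_holds (k : Strictness) (h : k.Holds G) : k.Holds (corelLift M G hG) := by
  cases k with
  | lax => trivial
  | strong => exact ⟨h.1, fun X Y => h.2 (.of X.obj) (.of Y.obj)⟩
  | strict => exact ⟨h.1, fun X Y => h.2 (.of X.obj) (.of Y.obj)⟩

/-- The symmetry of corelations is the class of the symmetry of cospans, so the condition is the one
for `G`. -/
theorem corelLift_symmetric [SymmetricCategory C] [SymmetricCategory B]
    (h : IsSymmetricFunctor G) : IsSymmetricFunctor (corelLift M G hG) :=
  fun X Y => h (.of X.obj) (.of Y.obj)

/-- The factorisation through Γ holds with the lax structures included: as Γ is strict, its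
structure morphisms are identities and contribute only images of identities under `G`. -/
theorem of_cospanToCorel_comp_corelLift [SymmetricCategory C] :
    LaxMonoidalFunctor.of (cospanToCorel M ⋙ corelLift M G hG) = LaxMonoidalFunctor.of G := by
  refine laxMonoidalFunctor_of_eq (cospanToCorel_comp_corelLift M G hG) (heq_of_eq ?_) (heq_of_eq ?_)
  · exact (congrArg (ε G ≫ ·) (G.map_id _)).trans (Category.comp_id _)
  · exact funext fun X => funext fun Y =>
      (congrArg (μ G _ _ ≫ ·) (G.map_id _)).trans (Category.comp_id _)

end MonoidalDescent

/-! ### The square and its universal property -/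

section Square

variable {C : Type u} [Category.{v} C] [MonoidalCategory C] [SymmetricCategory C] [HasPushouts C]
  [HasPullbacks C] [TensorPreservesPushouts C]

/-- If a functor on cospans agrees on zigzags with a functor on spans, it sends `m ∈ M` followed by
`m` pointing backwards to an identity. -/
theorem map_fwd_comp_bwd_eq_id {A M : MorphismProperty C}
    [A.IsStableUnderBaseChange] [TensorPreservesPullbacks A] [A.IsMonoidal] {B : Type*} [Category* B]
    (hM : M ≤ .monomorphisms C) (hMA : M ≤ A) {F : SpanCat A ⥤ B} {G : CospanCat C ⥤ B}
    (h : zigzagToSpan A ⋙ F = zigzagToCospan A ⋙ G) {X Y : C} (m : X ⟶ Y) (hm : M m) :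
    G.map ((CospanMod.fwd m : (.of X : CospanCat C) ⟶ .of Y) ≫ CospanMod.bwd m) = 𝟙 _ := by
  have : Mono m := hM m hm
  have hA := hMA m hm
  -- The zigzag that transports the relation: it becomes an identity in spans, and in cospans it is
  -- the composite that `G` has to send to an identity.
  let z : (ZigzagCat.of X : ZigzagCat A) ⟶ .of X := ZigzagCat.fwd m hA ≫ ZigzagCat.bwd m hA
  have h₁ : (zigzagToSpan A ⋙ F).map z = 𝟙 _ := by
    refine (congrArg F.map (((zigzagToSpan A).map_comp _ _).trans ?_)).trans (F.map_id _)
    exact (congrArg₂ (· ≫ ·) (zigzagToSpan_fwd A m hA) (zigzagToSpan_bwd A m hA)).trans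
      (SpanCat.fwd_comp_bwd_of_mono m hA)
  -- Replacing the whole functor, in a statement about an endomorphism, changes its objects along
  -- with it and avoids any transport along the equality of `F` and `G` on objects.
  rw [h] at h₁
  refine (congrArg G.map (((zigzagToCospan A).map_comp _ _).trans ?_)).symm.trans h₁
  exact congrArg₂ (· ≫ ·) (zigzagToCospan_fwd A m hA) (zigzagToCospan_bwd A m hA)

variable (A M : MorphismProperty C) [M.IsStableUnderCobaseChange]
  [A.IsStableUnderBaseChange] [CanonicalMapsIn A M] [TensorPreservesPullbacks A] [M.IsMonoidal]
  [A.IsMonoidal]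

/-- Both composites act in the same way on objects, so equality on morphisms is naturality of the
family of identities, which needs checking only on single forward and backward morphisms. There the
span has an identity leg, and its pushout is the cospan given by the same morphism. -/
theorem zigzag_square : zigzagToSpan A ⋙ spanToCorel A M = zigzagToCospan A ⋙ cospanToCorel M := by
  refine CategoryTheory.Functor.hext (fun _ => rfl) (fun X Y a => heq_of_eq ?_)
  have := ZigzagCat.naturality_of_generators
    (F := zigzagToSpan A ⋙ spanToCorel A M) (G := zigzagToCospan A ⋙ cospanToCorel M)
    (fun X => 𝟙 (.of X.obj : CorelCat M)) ?_ ?_ a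
  · exact (Category.comp_id _).symm.trans (this.trans (Category.id_comp _))
  · intro X Y f hf
    refine (Category.comp_id _).trans (Eq.trans ?_ (Category.id_comp _).symm)
    exact ((congrArg (spanToCorel A M).map (zigzagToSpan_fwd A f hf)).trans
      (spanToCorel_fwd A M f hf)).trans
      (congrArg (cospanToCorel M).map (zigzagToCospan_fwd A f hf)).symm
  · intro X Y f hf
    refine (Category.comp_id _).trans (Eq.trans ?_ (Category.id_comp _).symm)
    exact ((congrArg (spanToCorel A M).map (zigzagToSpan_bwd A f hf)).trans
      (spanToCorel_map_homMk A M _ _ (IsPushout.of_id_snd (f := f)))).trans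
      (congrArg (cospanToCorel M).map (zigzagToCospan_bwd A f hf)).symm

theorem zigzag_square_laxMonoidal :
    LaxMonoidalFunctor.of (zigzagToSpan A ⋙ spanToCorel A M) =
      LaxMonoidalFunctor.of (zigzagToCospan A ⋙ cospanToCorel M) := by
  refine laxMonoidalFunctor_of_eq (zigzag_square A M) (heq_of_eq ?_) (heq_of_eq ?_)
  -- All structure morphisms are identities, but Π does not preserve identities definitionally: it
  -- takes a chosen pushout of two identities. Hence `map_id` is invoked for Π, while for Γ it holds
  -- by definition.
  · exact congrArg (𝟙 (𝟙_ (CorelCat M)) ≫ ·) ((spanToCorel A M).map_id _)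
  · exact funext fun X => funext fun Y =>
      congrArg (𝟙 (.of (X.obj ⊗ Y.obj) : CorelCat M) ≫ ·) ((spanToCorel A M).map_id _)

/-- The square of zigzags, spans, cospans and corelations is a pushout in each wide subcategory of
the category of symmetric monoidal categories and lax monoidal functors that contains the square
and the functors on corelations induced by its functors on cospans. -/
theorem isPushout_wideSubcategory (hM : M ≤ .monomorphisms C) (hMA : M ≤ A)
    (P : MorphismProperty SymMonCat.{max u v, u}) [P.IsMultiplicative]
    (h₁ : P (X := .of (ZigzagCat A)) (Y := .of (SpanCat A)) (.of (zigzagToSpan A)))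
    (h₂ : P (X := .of (ZigzagCat A)) (Y := .of (CospanCat C)) (.of (zigzagToCospan A)))
    (h₃ : P (X := .of (SpanCat A)) (Y := .of (CorelCat M)) (.of (spanToCorel A M)))
    (h₄ : P (X := .of (CospanCat C)) (Y := .of (CorelCat M)) (.of (cospanToCorel M)))
    (hP : ∀ (Q : SymMonCat.{max u v, u}) (G : LaxMonoidalFunctor (CospanCat C) Q.carrier)
      (hG : ∀ {X Y : C} (m : X ⟶ Y), M m → G.toFunctor.map
        ((CospanMod.fwd m : (.of X : CospanCat C) ⟶ .of Y) ≫ CospanMod.bwd m) = 𝟙 _),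
      P (X := .of (CospanCat C)) (Y := Q) G →
        P (X := .of (CorelCat M)) (Y := Q) (.of (corelLift M G.toFunctor hG))) :
    IsPushout (C := WideSubcategory P)
      (⟨LaxMonoidalFunctor.of (zigzagToSpan A), h₁⟩ :
        (⟨.of (ZigzagCat A)⟩ : WideSubcategory P) ⟶ ⟨.of (SpanCat A)⟩)
      (⟨LaxMonoidalFunctor.of (zigzagToCospan A), h₂⟩ :
        (⟨.of (ZigzagCat A)⟩ : WideSubcategory P) ⟶ ⟨.of (CospanCat C)⟩)
      (⟨LaxMonoidalFunctor.of (spanToCorel A M), h₃⟩ :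
        (⟨.of (SpanCat A)⟩ : WideSubcategory P) ⟶ ⟨.of (CorelCat M)⟩)
      (⟨LaxMonoidalFunctor.of (cospanToCorel M), h₄⟩ :
        (⟨.of (CospanCat C)⟩ : WideSubcategory P) ⟶ ⟨.of (CorelCat M)⟩) := by
  have := epi_wideSubcategory (⟨LaxMonoidalFunctor.of (zigzagToSpan A), h₁⟩ :
      (⟨.of (ZigzagCat A)⟩ : WideSubcategory P) ⟶ ⟨.of (SpanCat A)⟩)
    (epi_of_full _ (zigzagToSpan_obj_surjective A) (zigzagToSpan_strict A))
  have := epi_wideSubcategory (⟨LaxMonoidalFunctor.of (cospanToCorel M), h₄⟩ :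
      (⟨.of (CospanCat C)⟩ : WideSubcategory P) ⟶ ⟨.of (CorelCat M)⟩)
    (epi_of_full _ (cospanToCorel_obj_surjective M) (cospanToCorel_strict M))
  -- The epimorphisms are the functor from zigzags to spans and Γ, so what remains is to factor the
  -- functor on cospans of each cocone through Γ.
  refine isPushout_of_epi (WideSubcategory.hom_ext _ (zigzag_square_laxMonoidal A M)) ?_
  rintro ⟨Q⟩ ⟨F, hF⟩ ⟨G, hGP⟩ h
  -- Descent is controlled by the underlying functors alone; the lax structures of the cocone play
  -- no part in verifying `hG`.
  have hFG : zigzagToSpan A ⋙ LaxMonoidalFunctor.toFunctor F =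
      zigzagToCospan A ⋙ LaxMonoidalFunctor.toFunctor G :=
    congrArg (fun k => LaxMonoidalFunctor.toFunctor k.hom) h
  have hG {X Y : C} (m : X ⟶ Y) (hm : M m) := map_fwd_comp_bwd_eq_id hM hMA hFG m hm
  -- Assumption `hP` ensures that the descended functor is again a morphism of the wide subcategory.
  exact ⟨⟨LaxMonoidalFunctor.of (corelLift M (LaxMonoidalFunctor.toFunctor G) hG), hP Q G hG hGP⟩,
    WideSubcategory.hom_ext _
      (of_cospanToCorel_comp_corelLift M (LaxMonoidalFunctor.toFunctor G) hG)⟩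

end Square

end Corelations

/-! ### The six pushouts -/

theorem mainTheorem5 {C : Type u} [Category.{v} C] [MonoidalCategory C] [SymmetricCategory C]
    [HasPushouts C] [HasPullbacks C] (E M A : MorphismProperty C)
    [Corelations.IsFactorisationSystem E M] [M.IsStableUnderCobaseChange]
    (hM : M ≤ MorphismProperty.monomorphisms C)
    [A.IsStableUnderBaseChange] (hMA : M ≤ A) [Corelations.CanonicalMapsIn A M]
    [Corelations.TensorPreservesPushouts C] [Corelations.TensorPreservesPullbacks A]
    [M.IsMonoidal] [A.IsMonoidal] :
    Corelations.Strictness.strict.Holds (Corelations.spanToCorel A M) ∧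
    Corelations.IsSymmetricFunctor (Corelations.spanToCorel A M) ∧
    Corelations.Strictness.strict.Holds (Corelations.cospanToCorel M) ∧
    Corelations.IsSymmetricFunctor (Corelations.cospanToCorel M) ∧
    ∀ k : Corelations.Strictness,
      IsPushout (C := Corelations.SymMonCatSymmetricWith.{max u v, u} k)
        (Corelations.symmetricMonoidalHom k (Corelations.zigzagToSpan A)
          (Corelations.zigzagToSpan_strict A) (Corelations.zigzagToSpan_symmetric A))
        (Corelations.symmetricMonoidalHom k (Corelations.zigzagToCospan A)
          (Corelations.zigzagToCospan_strict A) (Corelations.zigzagToCospan_symmetric A))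
        (Corelations.symmetricMonoidalHom k (Corelations.spanToCorel A M)
          (Corelations.spanToCorel_strict A M) (Corelations.spanToCorel_symmetric A M))
        (Corelations.symmetricMonoidalHom k (Corelations.cospanToCorel M)
          (Corelations.cospanToCorel_strict M) (Corelations.cospanToCorel_symmetric M)) ∧
      IsPushout (C := Corelations.SymMonCatWith.{max u v, u} k)
        (Corelations.monoidalHom k (Corelations.zigzagToSpan A)
          (Corelations.zigzagToSpan_strict A))
        (Corelations.monoidalHom k (Corelations.zigzagToCospan A)
          (Corelations.zigzagToCospan_strict A))
        (Corelations.monoidalHom k (Corelations.spanToCorel A M)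
          (Corelations.spanToCorel_strict A M))
        (Corelations.monoidalHom k (Corelations.cospanToCorel M)
          (Corelations.cospanToCorel_strict M)) := by
  refine ⟨Corelations.spanToCorel_strict A M, Corelations.spanToCorel_symmetric A M,
    Corelations.cospanToCorel_strict M, Corelations.cospanToCorel_symmetric M, fun k => ⟨?_, ?_⟩⟩
  -- The four placeholders are the memberships of the sides of the square, read off from the goal.
  -- What has to be supplied is that the class of functors is closed under descent: strictness and
  -- symmetry here, strictness alone in the last case.
  · exact Corelations.isPushout_wideSubcategory A M hM hMA
      (Corelations.symmetricMonoidalFunctors k) _ _ _ _ fun Q G hG h =>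
        ⟨Corelations.corelLift_holds M G.toFunctor hG k h.1,
          Corelations.corelLift_symmetric M G.toFunctor hG h.2⟩
  · exact Corelations.isPushout_wideSubcategory A M hM hMA
      (Corelations.monoidalFunctors k) _ _ _ _ fun Q G hG h =>
        Corelations.corelLift_holds M G.toFunctor hG k h
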